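/- Work over $\mathbb{C}$, let $n\ge 0$ be an integer, and let $C,D\subset\mathbb{P}^n$ be non-degenerate rational curves of degree $n+1$, with birational parameterizations $\mathbf p,\mathbf q:\mathbb{P}^1\to\mathbb{P}^n$, $\mathbf p(\mathbb{P}^1)=C$, $\mathbf q(\mathbb{P}^1)=D$. That is, $\mathbf p=[p_0:\dots:p_n]$, where $p_0,\dots,p_n\in\mathbb{C}[s,t]$ are homogeneous of degree $n+1$, have no common factor and are linearly independent over $\mathbb{C}$, and $\mathbf p$ is injective outside a finite subset of $\mathbb{P}^1$; likewise for $\mathbf q$. The osculating polynomial of $\mathbf p$ is the binary form $$\Delta_{\mathbf p}(s,t)=\det\left[\frac{\partial^n \mathbf p}{\partial s^n},\frac{\partial^n \mathbf p}{\partial s^{n-1}\partial t},\dots,\frac{\partial^n \mathbf p}{\partial t^n}\right].$$ Let $\mathrm{Aut}(\mathbb{P}^m)=PGL_{m+1}(\mathbb{C})$ be the group of projective transformations of $\mathbb{P}^m$, put $\mathrm{Aut}(\mathbb{P}^n)_{C,D}=\{\varphi\in\mathrm{Aut}(\mathbb{P}^n):\varphi(C)=D\}$ and, for binary forms $F,G$,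 put $\mathrm{Aut}(\mathbb{P}^1)_{F,G}=\{\psi\in\mathrm{Aut}(\mathbb{P}^1):\ G\circ\psi=\lambda F\text{ for some }\lambda\in\mathbb{C}^*\}$. Then: 1. For every $\varphi\in\mathrm{Aut}(\mathbb{P}^n)_{C,D}$ there is exactly one $\psi\in\mathrm{Aut}(\mathbb{P}^1)$ with $\varphi\circ\mathbf p=\mathbf q\circ\psi$, namely $\iota(\varphi)=\mathbf q^{-1}\circ\varphi\circ\mathbf p$; it lies in $\mathrm{Aut}(\mathbb{P}^1)_{\Delta_{\mathbf p},\Delta_{\mathbf q}}$; and the map $$\iota:\mathrm{Aut}(\mathbb{P}^n)_{C,D}\to\mathrm{Aut}(\mathbb{P}^1)_{\Delta_{\mathbf p},\Delta_{\mathbf q}}$$ is a bijection. 2. Consequently, $C$ and $D$ are projectively equivalent (that is, $\mathrm{Aut}(\mathbb{P}^n)_{C,D}\neq\emptyset$) if and only if their osculating polynomials are equivalent (that is, $\mathrm{Aut}(\mathbb{P}^1)_{\Delta_{\mathbf p},\Delta_{\mathbf q}}\neq\emptyset$). -/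

import Mathlib

open MvPolynomial
open scoped LinearAlgebra.Projectivization MatrixGroups

noncomputable section

namespace OsculatingCurves

/-- Complex projective space `ℙⁿ`, the set of lines through the origin of `ℂⁿ⁺¹`. -/
abbrev ProjSpace (n : ℕ) : Type := ℙ ℂ (Fin (n + 1) → ℂ)

/-- The group `Aut(ℙⁿ)` of projective transformations; it acts on `ProjSpace n` by `•`. -/
abbrev ProjAut (n : ℕ) : Type := PGL(Fin (n + 1), ℂ)

/-- Polynomials in the homogeneous coordinates `s = X 0`, `t = X 1` of `ℙ¹`. -/
abbrev BinPoly : Type := MvPolynomial (Fin 2) ℂ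

/-- `Aut(ℙⁿ)_{A,B}`, the projective transformations carrying the set `A` onto the set `B`. -/
def projEquivs {n : ℕ} (A B : Set (ProjSpace n)) : Set (ProjAut n) :=
  {φ | (fun x => φ • x) '' A = B}

/-- The substitution `G ∘ A` of a linear transformation `A` in a binary form `G`. -/
def substForm (A : GL (Fin 2) ℂ) (G : BinPoly) : BinPoly :=
  aeval (fun i : Fin 2 => ∑ j : Fin 2, C (A i j) * (X j : BinPoly)) G

/-- `Aut(ℙ¹)_{F,G}`, the automorphisms `ψ` of `ℙ¹` with `G ∘ ψ = μ F` for some `μ ≠ 0`. For a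
homogeneous `G` the condition does not depend on the matrix `A` that represents `ψ`. -/
def formEquivs (F G : BinPoly) : Set (ProjAut 1) :=
  {ψ | ∃ A : GL (Fin 2) ℂ, Matrix.ProjGenLinGroup.mk A = ψ ∧
    ∃ μ : ℂ, μ ≠ 0 ∧ substForm A G = C μ * F}

lemma aeval_mul_of_homogeneous {R : Type*} [CommRing R] [Algebra ℂ R] {d : ℕ} {f : BinPoly}
    (hf : f.IsHomogeneous d) (c : R) (g : Fin 2 → R) :
    aeval (fun j => c * g j) f = c ^ d * aeval g f := by
  conv_lhs => rw [f.as_sum]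
  conv_rhs => rw [f.as_sum]
  simp only [map_sum, Finset.mul_sum]
  refine Finset.sum_congr rfl fun m hm => ?_
  have hdeg : d = ∑ i ∈ m.support, m i := hf.degree_eq_sum_deg_support hm
  simp only [aeval_monomial, Finsupp.prod, mul_pow, Finset.prod_mul_distrib,
    Finset.prod_pow_eq_pow_sum, ← hdeg]
  ring

/-- A binary form that vanishes at the point `[v 0 : v 1]` is divisible by the linear form
`(v 1) s - (v 0) t`. -/
lemma linear_dvd_of_eval_eq_zero {d : ℕ} {f : BinPoly} (hf : f.IsHomogeneous d)
    {v : Fin 2 → ℂ} (hv : v ≠ 0) (h0 : eval v f = 0) :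
    (C (v 1) * X 0 - C (v 0) * X 1 : BinPoly) ∣ f := by
  obtain ⟨i, hi⟩ : ∃ i, v i ≠ 0 := by
    by_contra hcon
    push Not at hcon
    exact hv (funext hcon)
  set L : BinPoly := C (v 1) * X 0 - C (v 0) * X 1 with hL
  let π := Ideal.Quotient.mk (Ideal.span {L})
  have hLpi : π L = 0 := Ideal.Quotient.eq_zero_iff_mem.2 (Ideal.mem_span_singleton_self L)
  have key : ∀ j, π (C (v i) * X j) = π (C (v j) * X i) := by
    have h10 : π (C (v 1) * X 0) = π (C (v 0) * X 1) := by
      rw [← sub_eq_zero, ← map_sub]; exact hLpi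
    intro j
    fin_cases i <;> fin_cases j
    · rfl
    · exact h10.symm
    · exact h10
    · rfl
  have e1 : aeval (fun j => C (v i) * X j : Fin 2 → BinPoly) f = C (v i) ^ d * f := by
    rw [aeval_mul_of_homogeneous hf]; simp
  have e2 : aeval (fun j => C (v j) * X i : Fin 2 → BinPoly) f = 0 := by
    have h1 : (fun j => C (v j) * X i : Fin 2 → BinPoly) = fun j => X i * C (v j) := by
      funext j; ring
    have h2 : aeval (fun j => C (v j) : Fin 2 → BinPoly) f = C (eval v f) := by
      have := MvPolynomial.aeval_algebraMap_apply BinPoly v f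
      simpa [MvPolynomial.algebraMap_eq, Function.comp_def, MvPolynomial.coe_aeval_eq_eval] using this
    rw [h1, aeval_mul_of_homogeneous hf, h2, h0]; simp
  have e3 : π (C (v i) ^ d * f) = 0 := by
    rw [← e1, ← map_zero π, ← e2]
    rw [aeval_def, aeval_def, hom_eval₂, hom_eval₂]
    congr 1
    funext j
    exact key j
  have e4 : L ∣ C (v i) ^ d * f :=
    Ideal.mem_span_singleton.1 (Ideal.Quotient.eq_zero_iff_mem.1 e3)
  have hu : IsUnit (C (v i) ^ d : BinPoly) := ((isUnit_iff_ne_zero.2 hi).map C).pow d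
  exact (hu.dvd_mul_left).1 e4

/-- A morphism `ℙ¹ → ℙⁿ` given by forms `p₀, …, pₙ` of degree `d` without a common factor. -/
structure ProjLineMorphism (n d : ℕ) where
  coord : Fin (n + 1) → BinPoly
  isHomogeneous : ∀ i, (coord i).IsHomogeneous d
  no_common_factor : ∀ f : BinPoly, (∀ i, f ∣ coord i) → IsUnit f

namespace ProjLineMorphism

variable {n d : ℕ}

/-- The vector `(p₀(v), …, pₙ(v))`. -/
def vec (p : ProjLineMorphism n d) (v : Fin 2 → ℂ) : Fin (n + 1) → ℂ :=
  fun i => eval v (p.coord i)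

lemma vec_smul (p : ProjLineMorphism n d) (c : ℂ) (v : Fin 2 → ℂ) :
    p.vec (c • v) = c ^ d • p.vec v := by
  funext i
  simp only [vec, Pi.smul_apply, smul_eq_mul]
  exact aeval_mul_of_homogeneous (p.isHomogeneous i) c v

lemma vec_ne_zero (p : ProjLineMorphism n d) {v : Fin 2 → ℂ} (hv : v ≠ 0) : p.vec v ≠ 0 := by
  intro h
  have hu := p.no_common_factor _ fun i =>
    linear_dvd_of_eval_eq_zero (p.isHomogeneous i) hv (congrFun h i)
  have := hu.map (eval v)
  simp [mul_comm] at this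

/-- The morphism `ℙ¹ → ℙⁿ` as a map of points, `[s : t] ↦ [p₀(s, t) : ⋯ : pₙ(s, t)]`. -/
def toMap (p : ProjLineMorphism n d) : ProjSpace 1 → ProjSpace n :=
  Projectivization.lift
    (fun v : {v : Fin 2 → ℂ // v ≠ 0} => Projectivization.mk ℂ (p.vec v) (p.vec_ne_zero v.2))
    (by
      rintro ⟨v, hv⟩ ⟨w, hw⟩ c (rfl : v = c • w)
      have hc : c ≠ 0 := by rintro rfl; simp at hv
      refine (Projectivization.mk_eq_mk_iff' ℂ _ _ _ _).2 ⟨c ^ d, ?_⟩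
      exact (p.vec_smul c w).symm)

@[simp]
lemma toMap_mk (p : ProjLineMorphism n d) (v : Fin 2 → ℂ) (hv : v ≠ 0) :
    p.toMap (Projectivization.mk ℂ v hv) = Projectivization.mk ℂ (p.vec v) (p.vec_ne_zero hv) :=
  rfl

/-- The osculating polynomial `Δ_p`, the determinant of the `n + 1` columns
`∂ⁿp/∂sⁿ⁻ᵏ∂tᵏ`, `k = 0, …, n`. -/
def osculating (p : ProjLineMorphism n d) : BinPoly :=
  Matrix.det (Matrix.of fun i k : Fin (n + 1) =>
    (pderiv (0 : Fin 2))^[n - (k : ℕ)] ((pderiv (1 : Fin 2))^[(k : ℕ)] (p.coord i)))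

end ProjLineMorphism

/-- A birational parameterization `p : ℙ¹ → C` of a non-degenerate rational curve `C ⊂ ℙⁿ` of
degree `d`: the map is injective outside a finite set of parameters, and the coordinate forms are
linearly independent, that is, the image lies in no hyperplane. -/
structure RationalCurve (n d : ℕ) extends ProjLineMorphism n d where
  birational : ∃ S : Set (ProjSpace 1), S.Finite ∧ Set.InjOn toProjLineMorphism.toMap Sᶜ
  nondegenerate : LinearIndependent ℂ coord

/-- The curve itself, as a subset of `ℙⁿ`. -/
def RationalCurve.points {n d : ℕ} (p : RationalCurve n d) : Set (ProjSpace n) :=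
  Set.range p.toMap

end OsculatingCurves

end

noncomputable section

namespace OsculatingCurves

/-! For matrices `M`, `A` representing φ, ψ, the relation φ ∘ p = q ∘ ψ means that the vectors of
forms M p and q ∘ A agree up to a nonzero constant (`toMap_eq_smul_iff`). Hence ψ comes from some φ
exactly when all qᵢ ∘ A lie in the span V of the pᵢ, and φ is then unique since the pᵢ are
independent.

Degree n + 1 is what makes V a hyperplane in the space of forms: that space has dimension n + 2, and
V is the kernel of f ↦ det(p₀, …, pₙ, f), the `detFunctional`. On the (n+1)-st power of the linear
form vanishing at v this functional is a nonzero constant times Δ_p(v)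
(`detFunctional_linearForm_pow`). Such powers span all forms, so V and Δ_p, up to scalars, determine
each other. Powers of linear forms are carried to one another by substitutions up to a power of det
A, so the qᵢ ∘ A lie in V if and only if Δ_q ∘ A is proportional to Δ_p (`substForm_mem_span_iff`).

It remains to lift a φ with φ(C) = D to the parameters (`exists_eq_substForm_of_range_subset`). For
almost all u there is exactly one y with φ(p(u)) = q(y). In characteristic zero such a unique common
root is a rational function α/β of u (`exists_rational_common_root`). Comparing degrees in lowest
terms shows that α/β has degree 1. Generic injectivity of q makes the lift unique. -/

/-! ### Proportional vectors over a factorial ring -/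

/-- Each prime factor of `a` fails to divide some `p i`, so it divides `b` and can be cancelled. -/
lemma dvd_of_forall_dvd_mul_of_coprime {ι R : Type*} [CommRing R] [IsDomain R]
    [UniqueFactorizationMonoid R] {p : ι → R} (hp : ∀ f, (∀ i, f ∣ p i) → IsUnit f)
    {a b : R} (ha : a ≠ 0) (h : ∀ i, a ∣ b * p i) : a ∣ b := by
  induction a using UniqueFactorizationMonoid.induction_on_prime generalizing b with
  | h₁ => exact absurd rfl ha
  | h₂ x hx => exact hx.dvd
  | h₃ a π ha0 hπ ih =>
    obtain ⟨i, hi⟩ : ∃ i, ¬ π ∣ p i := by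
      by_contra! hcon
      exact hπ.not_isUnit (hp π hcon)
    obtain ⟨b, rfl⟩ : π ∣ b :=
      (hπ.dvd_or_dvd ((Dvd.intro _ rfl).trans (h i))).resolve_right hi
    refine mul_dvd_mul_left π (ih ha0 fun j => ?_)
    have := h j
    rw [mul_assoc] at this
    exact (mul_dvd_mul_iff_left hπ.ne_zero).1 this

/-- A vector proportional to a vector without common factor is a multiple of it. -/
lemma exists_eq_mul_of_cross_mul_eq {ι R : Type*} [CommRing R] [IsDomain R]
    [UniqueFactorizationMonoid R] {p r : ι → R} (hp : ∀ f, (∀ i, f ∣ p i) → IsUnit f)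
    (h : ∀ i j, r i * p j = r j * p i) : ∃ c, ∀ i, r i = c * p i := by
  obtain ⟨j, hj⟩ : ∃ j, p j ≠ 0 := by
    by_contra! hcon
    exact not_isUnit_zero (hp 0 fun i => by simp [hcon i])
  obtain ⟨c, hc⟩ : p j ∣ r j :=
    dvd_of_forall_dvd_mul_of_coprime hp hj fun i => ⟨r i, by rw [← h i j, mul_comm]⟩
  refine ⟨c, fun i => mul_right_cancel₀ hj ?_⟩
  rw [h i j, hc]
  ring

lemma projectivization_mk_eq_mk_iff_cross {ι : Type*} {v w : ι → ℂ} (hv : v ≠ 0) (hw : w ≠ 0) :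
    Projectivization.mk ℂ v hv = Projectivization.mk ℂ w hw ↔ ∀ i j, v i * w j = v j * w i := by
  rw [Projectivization.mk_eq_mk_iff']
  constructor
  · rintro ⟨a, rfl⟩ i j
    simp only [Pi.smul_apply, smul_eq_mul]
    ring
  · intro h
    obtain ⟨j, hj⟩ := Function.ne_iff.1 hw
    refine ⟨v j / w j, funext fun i => ?_⟩
    have := h i j
    simp only [Pi.zero_apply, Pi.smul_apply, smul_eq_mul] at hj ⊢
    field_simp
    rw [mul_comm (w j), this, mul_comm]

lemma mk_smul_mk {n : ℕ} (M : GL (Fin (n + 1)) ℂ) {v : Fin (n + 1) → ℂ} (hv : v ≠ 0) :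
    (Matrix.ProjGenLinGroup.mk M : ProjAut n) • Projectivization.mk ℂ v hv =
      Projectivization.mk ℂ (M • v) ((smul_ne_zero_iff_ne M).2 hv) :=
  rfl

/-! ### Linear substitutions and equality of morphisms -/

/-- After multiplication by t both sides also agree where t = 0. -/
lemma eq_of_forall_eval_eq {f g : BinPoly} (h : ∀ v : Fin 2 → ℂ, v 1 ≠ 0 → eval v f = eval v g) :
    f = g := by
  refine mul_left_cancel₀ (X_ne_zero (R := ℂ) (1 : Fin 2)) (MvPolynomial.funext fun v => ?_)
  by_cases hv : v 1 = 0
  · simp [hv]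
  · simp [h v hv]

lemma eval_substForm (A : GL (Fin 2) ℂ) (G : BinPoly) (v : Fin 2 → ℂ) :
    eval v (substForm A G) = eval (A • v) G := by
  have h : (aeval v : BinPoly →ₐ[ℂ] ℂ).comp
      (aeval fun i : Fin 2 => ∑ j : Fin 2, C (A i j) * (X j : BinPoly)) = aeval (A • v) := by
    ext i
    simp only [AlgHom.comp_apply, aeval_X, map_sum, map_mul, algHom_C]
    rfl
  exact DFunLike.congr_fun h G

lemma isHomogeneous_substForm (A : GL (Fin 2) ℂ) {G : BinPoly} {d : ℕ} (hG : G.IsHomogeneous d) :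
    (substForm A G).IsHomogeneous d := by
  have := hG.aeval (n := 1) (fun i : Fin 2 => ∑ j : Fin 2, C (A i j) * (X j : BinPoly)) fun i =>
    IsHomogeneous.sum _ _ _ fun j _ => isHomogeneous_C_mul_X (A i j) j
  simpa [substForm] using this

lemma isHomogeneous_sum_C_mul {m d : ℕ} (a : Fin m → ℂ) {f : Fin m → BinPoly}
    (hf : ∀ i, (f i).IsHomogeneous d) : (∑ j, C (a j) * f j).IsHomogeneous d :=
  IsHomogeneous.sum _ _ _ fun j _ => by simpa using (isHomogeneous_C _ (a j)).mul (hf j)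

namespace ProjLineMorphism

variable {n d : ℕ}

lemma sum_inv_mul_sum (M : GL (Fin (n + 1)) ℂ) (f : Fin (n + 1) → BinPoly) (i : Fin (n + 1)) :
    ∑ j, C ((M⁻¹ : GL (Fin (n + 1)) ℂ) i j) * ∑ k, C (M j k) * f k = f i := by
  have h : ∀ k, ∑ j, (M⁻¹ : GL (Fin (n + 1)) ℂ) i j * M j k = if i = k then 1 else 0 := fun k => by
    have := congrFun (congrFun (Units.inv_mul M) i) k
    rwa [Matrix.mul_apply, Matrix.one_apply] at this
  simp_rw [Finset.mul_sum, ← mul_assoc, ← C_mul]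
  rw [Finset.sum_comm]
  simp_rw [← Finset.sum_mul, ← map_sum, h]
  simp

/-- The composition of a morphism to `ℙⁿ` with a linear change of coordinates. -/
def transform (p : ProjLineMorphism n d) (M : GL (Fin (n + 1)) ℂ) : ProjLineMorphism n d where
  coord i := ∑ j, C (M i j) * p.coord j
  isHomogeneous i := isHomogeneous_sum_C_mul _ p.isHomogeneous
  no_common_factor f hf := p.no_common_factor f fun i => by
    rw [← sum_inv_mul_sum M p.coord i]
    exact Finset.dvd_sum fun j _ => (hf j).mul_left _

lemma vec_transform (p : ProjLineMorphism n d) (M : GL (Fin (n + 1)) ℂ) (v : Fin 2 → ℂ) :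
    (p.transform M).vec v = M • p.vec v := by
  funext i
  simp [vec, transform, Units.smul_def, Matrix.mulVec, dotProduct]

lemma toMap_transform (p : ProjLineMorphism n d) (M : GL (Fin (n + 1)) ℂ) (x : ProjSpace 1) :
    (p.transform M).toMap x = (Matrix.ProjGenLinGroup.mk M : ProjAut n) • p.toMap x := by
  induction x using Projectivization.ind with
  | h v hv => simp [vec_transform]

lemma toMap_mk_eq_toMap_mk_iff (p q : ProjLineMorphism n d) {v w : Fin 2 → ℂ} (hv : v ≠ 0)
    (hw : w ≠ 0) : p.toMap (Projectivization.mk ℂ v hv) = q.toMap (Projectivization.mk ℂ w hw) ↔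
      ∀ i j, eval v (p.coord i) * eval w (q.coord j) = eval v (p.coord j) * eval w (q.coord i) := by
  rw [toMap_mk, toMap_mk, projectivization_mk_eq_mk_iff_cross]
  rfl

/-- `p = q ∘ A` as maps if and only if this holds for the coordinate forms, up to a constant. -/
theorem toMap_eq_smul_iff (p q : ProjLineMorphism n d) (A : GL (Fin 2) ℂ) :
    (∀ x, p.toMap x = q.toMap ((Matrix.ProjGenLinGroup.mk A : ProjAut 1) • x)) ↔
      ∃ c : ℂ, c ≠ 0 ∧ ∀ i, p.coord i = C c * substForm A (q.coord i) := by
  constructor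
  · intro h
    have hcross : ∀ i j, substForm A (q.coord i) * p.coord j =
        substForm A (q.coord j) * p.coord i := by
      intro i j
      refine eq_of_forall_eval_eq fun v hv1 => ?_
      have hv : v ≠ 0 := fun h0 => hv1 (congrFun h0 1)
      have := h (Projectivization.mk ℂ v hv)
      rw [mk_smul_mk, toMap_mk_eq_toMap_mk_iff] at this
      simp only [map_mul, eval_substForm]
      rw [mul_comm, this j i]
      ring
    obtain ⟨c, hc⟩ := exists_eq_mul_of_cross_mul_eq p.no_common_factor hcross
    obtain ⟨j, hj⟩ : ∃ j, substForm A (q.coord j) ≠ 0 := by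
      by_contra! hcon
      have hv : A • (fun _ => 1 : Fin 2 → ℂ) ≠ 0 :=
        (smul_ne_zero_iff_ne A).2 fun h0 => one_ne_zero (congrFun h0 0)
      refine q.vec_ne_zero hv (funext fun i => ?_)
      rw [vec, ← eval_substForm, hcon i, map_zero, Pi.zero_apply]
    have hc0 : c ≠ 0 := by
      rintro rfl
      exact hj (by rw [hc, zero_mul])
    have hpj : p.coord j ≠ 0 := fun h0 => hj (by rw [hc, h0, mul_zero])
    -- Both vectors consist of forms of degree `d`, so the factor `c` has degree 0.
    have hdeg := totalDegree_mul_of_isDomain hc0 hpj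
    rw [← hc, (isHomogeneous_substForm A (q.isHomogeneous j)).totalDegree hj,
      (p.isHomogeneous j).totalDegree hpj] at hdeg
    have hcC := totalDegree_eq_zero_iff_eq_C.1 (by omega : c.totalDegree = 0)
    have ha : coeff 0 c ≠ 0 := fun h0 => hc0 (by rw [hcC, h0, C_0])
    refine ⟨(coeff 0 c)⁻¹, inv_ne_zero ha, fun i => ?_⟩
    rw [hc i, hcC, ← mul_assoc, ← C_mul, coeff_C, if_pos rfl, inv_mul_cancel₀ ha, C_1, one_mul]
  · rintro ⟨c, hc, h⟩ x
    induction x using Projectivization.ind with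
    | h v hv =>
      rw [mk_smul_mk, toMap_mk_eq_toMap_mk_iff]
      intro i j
      simp only [h, map_mul, eval_C, eval_substForm]
      ring

end ProjLineMorphism

/-! ### A unique common root is a rational function -/

/-- Pseudo-division by an element of minimal degree of an ideal of `R[y]`. -/
lemma exists_leadingCoeff_pow_mul_dvd {R : Type*} [CommRing R] [IsDomain R]
    {J : Ideal (Polynomial R)} {g : Polynomial R} (hg : g ∈ J)
    (hmin : ∀ f ∈ J, f ≠ 0 → g.natDegree ≤ f.natDegree) :
    ∀ f ∈ J, ∃ N : ℕ, g ∣ Polynomial.C (g.leadingCoeff ^ N) * f := by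
  intro f
  induction hk : f.degree using WellFoundedLT.induction generalizing f with
  | ind k ih =>
    intro hf
    by_cases hf0 : f = 0
    · exact ⟨0, by simp [hf0]⟩
    by_cases hg0 : g = 0
    · exact ⟨1, by simp [hg0]⟩
    have hle := hmin f hf hf0
    -- The leading terms cancel; multiplying by the leading coefficient of `g` replaces division by
    -- it.
    set f' := Polynomial.C g.leadingCoeff * f -
      Polynomial.C f.leadingCoeff * Polynomial.X ^ (f.natDegree - g.natDegree) * g with hf'
    have hf'J : f' ∈ J := J.sub_mem (J.mul_mem_left _ hf) (J.mul_mem_left _ hg)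
    have hdeg : f'.degree < f.degree := by
      have hlg : g.leadingCoeff ≠ 0 := Polynomial.leadingCoeff_ne_zero.2 hg0
      have hlf : f.leadingCoeff ≠ 0 := Polynomial.leadingCoeff_ne_zero.2 hf0
      have h1 : (Polynomial.C g.leadingCoeff * f).degree = f.degree :=
        Polynomial.degree_C_mul hlg
      rw [hf', ← h1]
      refine Polynomial.degree_sub_lt_left ?_ ?_ ?_
      · rw [h1, mul_assoc, Polynomial.degree_C_mul hlf, Polynomial.degree_mul,
          Polynomial.degree_X_pow, Polynomial.degree_eq_natDegree hf0,
          Polynomial.degree_eq_natDegree hg0]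
        norm_cast
        omega
      · exact mul_ne_zero (Polynomial.C_ne_zero.2 hlg) hf0
      · simp only [Polynomial.leadingCoeff_mul, Polynomial.leadingCoeff_C,
          Polynomial.leadingCoeff_X_pow]
        ring
    obtain ⟨N, hN⟩ := ih _ (hk ▸ hdeg) f' rfl hf'J
    refine ⟨N + 1, ?_⟩
    have : Polynomial.C (g.leadingCoeff ^ (N + 1)) * f = Polynomial.C (g.leadingCoeff ^ N) * f' +
        Polynomial.C (g.leadingCoeff ^ N) * (Polynomial.C f.leadingCoeff *
          Polynomial.X ^ (f.natDegree - g.natDegree)) * g := by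
      rw [hf', pow_succ, Polynomial.C_mul]
      ring
    rw [this]
    exact dvd_add hN (Dvd.intro_left _ rfl)

lemma eventually_cofinite_eval_ne_zero {f : Polynomial ℂ} (hf : f ≠ 0) :
    ∀ᶠ u in Filter.cofinite, f.eval u ≠ 0 := by
  simpa [Filter.eventually_cofinite] using Polynomial.finite_setOfPred_isRoot hf

/-- If for almost all `u` the polynomials `f(u, y)` with `f` in an ideal `J` of `ℂ[u][y]` have
exactly one common root, then that root is a rational function of `u`. -/
theorem exists_rational_common_root (J : Ideal (Polynomial (Polynomial ℂ)))
    (h : ∀ᶠ u in Filter.cofinite,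
      ∃! y : ℂ, ∀ f ∈ J, (f.map (Polynomial.evalRingHom u)).eval y = 0) :
    ∃ α β : Polynomial ℂ, β ≠ 0 ∧ ∀ᶠ u in Filter.cofinite,
      ∀ f ∈ J, (f.map (Polynomial.evalRingHom u)).eval (α.eval u / β.eval u) = 0 := by
  obtain ⟨f₀, hf₀, hf₀'⟩ : ∃ f ∈ J, f ≠ 0 := by
    by_contra! hcon
    obtain ⟨u, y, -, hy⟩ := h.exists
    have h0 : ∀ z : ℂ, ∀ f ∈ J, (f.map (Polynomial.evalRingHom u)).eval z = 0 :=
      fun z f hf => by simp [hcon f hf]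
    -- If `J` were zero, every number would be a common root, against uniqueness.
    have := (hy (y + 1) (h0 _)).trans (hy y (h0 _)).symm
    simp at this
  have hex : ∃ k, ∃ f ∈ J, f ≠ 0 ∧ f.natDegree = k := ⟨_, f₀, hf₀, hf₀', rfl⟩
  classical
  obtain ⟨g, hgJ, hg0, hgm⟩ := Nat.find_spec hex
  have hmin : ∀ f ∈ J, f ≠ 0 → g.natDegree ≤ f.natDegree := fun f hf hf0 =>
    hgm ▸ Nat.find_min' hex ⟨f, hf, hf0, rfl⟩
  have hlg : g.leadingCoeff ≠ 0 := Polynomial.leadingCoeff_ne_zero.2 hg0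
  have hroots : ∀ᶠ u in Filter.cofinite, g.leadingCoeff.eval u ≠ 0 ∧ ∃ y : ℂ,
      (∀ f ∈ J, (f.map (Polynomial.evalRingHom u)).eval y = 0) ∧
      ∀ z, (g.map (Polynomial.evalRingHom u)).eval z = 0 → z = y := by
    -- Where the leading coefficient of `g` does not vanish, pseudo-division makes each root of g(u,
    -- ·) a common root of `J`, so `g` alone has only one root.
    filter_upwards [h, eventually_cofinite_eval_ne_zero hlg] with u ⟨y, hy, huniq⟩ hu
    refine ⟨hu, y, hy, fun z hz => huniq z fun f hf => ?_⟩
    obtain ⟨N, k, hk⟩ := exists_leadingCoeff_pow_mul_dvd hgJ hmin f hf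
    have := congrArg (fun f => (f.map (Polynomial.evalRingHom u)).eval z) hk
    simpa [hz, hu] using this
  have hkey : ∀ᶠ u in Filter.cofinite, g.leadingCoeff.eval u ≠ 0 ∧ g.natDegree ≠ 0 ∧
      ∀ f ∈ J, (f.map (Polynomial.evalRingHom u)).eval
        (-(g.coeff (g.natDegree - 1)).eval u / (g.natDegree * g.leadingCoeff.eval u)) = 0 := by
    filter_upwards [hroots] with u ⟨hu, y, hy, huniq⟩
    set G := g.map (Polynomial.evalRingHom u) with hG
    have hGdeg : G.natDegree = g.natDegree :=
      Polynomial.natDegree_map_of_leadingCoeff_ne_zero _ hu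
    have hGlead : G.leadingCoeff = g.leadingCoeff.eval u := by
      rw [Polynomial.leadingCoeff, hGdeg, hG, Polynomial.coeff_map]
      rfl
    have hG0 : G ≠ 0 := Polynomial.leadingCoeff_ne_zero.1 (hGlead ▸ hu)
    have hdeg0 : G.natDegree ≠ 0 := fun h0 => by
      have h1 := hy g hgJ
      rw [← hG, Polynomial.eq_C_of_natDegree_eq_zero h0, Polynomial.eval_C] at h1
      exact hG0 (by rw [Polynomial.eq_C_of_natDegree_eq_zero h0, h1, Polynomial.C_0])
    have hsplit : G.Splits := IsAlgClosed.splits G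
    -- With m its degree and a its leading coefficient, G = a(Y − y)ᵐ. Its next coefficient is −m a
    -- y, which expresses y rationally in u because m ≠ 0 in ℂ.
    have hrep : G.roots = Multiset.replicate G.natDegree y := by
      rw [Multiset.eq_replicate]
      exact ⟨hsplit.natDegree_eq_card_roots.symm,
        fun z hz => huniq z (Polynomial.isRoot_of_mem_roots hz)⟩
    have hnext := hsplit.nextCoeff_eq_neg_sum_roots_mul_leadingCoeff
    rw [hrep, Multiset.sum_replicate, Polynomial.nextCoeff_of_natDegree_pos (Nat.pos_of_ne_zero hdeg0),
      hGlead, hGdeg, nsmul_eq_mul, hG, Polynomial.coeff_map, Polynomial.coe_evalRingHom] at hnext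
    have hm : (g.natDegree : ℂ) ≠ 0 := Nat.cast_ne_zero.2 (hGdeg ▸ hdeg0)
    refine ⟨hu, hGdeg ▸ hdeg0, ?_⟩
    rw [hnext]
    convert hy using 5
    field_simp
  obtain ⟨-, -, hm, -⟩ := hkey.exists
  refine ⟨-g.coeff (g.natDegree - 1), Polynomial.C (g.natDegree : ℂ) * g.leadingCoeff,
    mul_ne_zero (Polynomial.C_ne_zero.2 (Nat.cast_ne_zero.2 hm)) hlg, ?_⟩
  filter_upwards [hkey] with u hu
  simpa only [Polynomial.eval_neg, Polynomial.eval_mul, Polynomial.eval_C] using hu.2.2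

/-! ### Polynomials substituted in a form, and the affine chart -/

/-- This is the value at infinity of the composition: only the coefficients of degree `e` contribute
to degree `d * e`, even if some `a i` has smaller degree. -/
lemma coeff_aeval_of_natDegree_le {d e : ℕ} {f : BinPoly} (hf : f.IsHomogeneous d)
    (a : Fin 2 → Polynomial ℂ) (ha : ∀ i, (a i).natDegree ≤ e) :
    (aeval a f).natDegree ≤ d * e ∧
      (aeval a f).coeff (d * e) = eval (fun i => (a i).coeff e) f := by
  have hterm : ∀ m ∈ f.support, ((aeval a (monomial m (coeff m f))).natDegree ≤ d * e ∧
      (aeval a (monomial m (coeff m f))).coeff (d * e) =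
        eval (fun i => (a i).coeff e) (monomial m (coeff m f))) := by
    intro m hm
    have hd : d = m 0 + m 1 := by
      have := hf (mem_support_iff.1 hm)
      rw [Finsupp.weight_apply, Finsupp.sum_fintype _ _ (by simp)] at this
      simpa using this.symm
    have e1 : aeval a (monomial m (coeff m f)) =
        Polynomial.C (coeff m f) * (a 0 ^ m 0 * a 1 ^ m 1) := by
      rw [aeval_monomial, Finsupp.prod_fintype _ _ (by simp)]
      simp
    have d0 := Polynomial.natDegree_pow_le_of_le (m 0) (ha 0)
    have d1 := Polynomial.natDegree_pow_le_of_le (m 1) (ha 1)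
    rw [e1, hd, add_mul]
    refine ⟨(Polynomial.natDegree_C_mul_le _ _).trans (Polynomial.natDegree_mul_le_of_le d0 d1), ?_⟩
    rw [Polynomial.coeff_C_mul, Polynomial.coeff_mul_add_eq_of_natDegree_le d0 d1,
      Polynomial.coeff_pow_of_natDegree_le (ha 0), Polynomial.coeff_pow_of_natDegree_le (ha 1),
      eval_monomial, Finsupp.prod_fintype _ _ (by simp)]
    simp
  conv => rw [f.as_sum]
  simp only [map_sum, Polynomial.finsetSum_coeff]
  exact ⟨Polynomial.natDegree_sum_le_of_forall_le _ _ fun m hm => (hterm m hm).1,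
    Finset.sum_congr rfl fun m hm => (hterm m hm).2⟩

lemma eval_aeval_polynomial (a : Fin 2 → Polynomial ℂ) (f : BinPoly) (u : ℂ) :
    (aeval a f).eval u = eval (fun i => (a i).eval u) f := by
  have h : (Polynomial.aeval u).comp (aeval a) =
      (aeval (fun i => (a i).eval u) : BinPoly →ₐ[ℂ] ℂ) := by
    ext i
    simp [Polynomial.coe_aeval_eq_eval]
  have := DFunLike.congr_fun h f
  simpa [Polynomial.coe_aeval_eq_eval] using this

lemma affine_ne_zero (y : ℂ) : (![y, 1] : Fin 2 → ℂ) ≠ 0 := fun h => by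
  simpa using congrFun h 1

/-- The point `[y : 1]` of the projective line. -/
def affinePoint (y : ℂ) : ProjSpace 1 := Projectivization.mk ℂ ![y, 1] (affine_ne_zero y)

lemma affinePoint_injective : Function.Injective affinePoint := by
  intro y z h
  have := (projectivization_mk_eq_mk_iff_cross _ _).1 h 0 1
  simpa using this

lemma finite_compl_range_affinePoint : (Set.range affinePoint)ᶜ.Finite := by
  have hne : (![1, 0] : Fin 2 → ℂ) ≠ 0 := fun h => by simpa using congrFun h 0
  refine (Set.finite_singleton (Projectivization.mk ℂ ![1, 0] hne : ProjSpace 1)).subset ?_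
  intro x hx
  induction x using Projectivization.ind with
  | h v hv =>
    rw [Set.mem_singleton_iff, projectivization_mk_eq_mk_iff_cross]
    have hv1 : v 1 = 0 := by
      by_contra hv1
      refine hx ⟨v 0 / v 1, ?_⟩
      rw [affinePoint, projectivization_mk_eq_mk_iff_cross]
      intro i j
      fin_cases i <;> fin_cases j <;> simp <;> field_simp
    intro i j
    fin_cases i <;> fin_cases j <;> simp [hv1]

namespace ProjLineMorphism

variable {n d : ℕ}

/-- Avoid the u whose image under `r` lies in the finite set `B` of images under `q` of its
exceptional parameters and of infinity. Only finitely many u are lost, as `r` is injective off a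
finite set. -/
lemma eventually_existsUnique_affinePoint {r q : ProjLineMorphism n d}
    (hr : ∃ S : Set (ProjSpace 1), S.Finite ∧ Set.InjOn r.toMap Sᶜ)
    (hq : ∃ S : Set (ProjSpace 1), S.Finite ∧ Set.InjOn q.toMap Sᶜ)
    (h : Set.range r.toMap ⊆ Set.range q.toMap) :
    ∀ᶠ u in Filter.cofinite, ∃! y, r.toMap (affinePoint u) = q.toMap (affinePoint y) := by
  obtain ⟨S, hS, hrS⟩ := hr
  obtain ⟨T, hT, hqT⟩ := hq
  set B := q.toMap '' (T ∪ (Set.range affinePoint)ᶜ) with hB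
  have hBfin : B.Finite := (hT.union finite_compl_range_affinePoint).image _
  have hpre : ((fun u => r.toMap (affinePoint u)) ⁻¹' B).Finite := by
    refine hBfin.preimage' fun b _ => ?_
    have hS' : (affinePoint ⁻¹' S).Finite := hS.preimage affinePoint_injective.injOn
    have hsub : ((fun u => r.toMap (affinePoint u)) ⁻¹' {b} \ affinePoint ⁻¹' S).Subsingleton := by
      rintro u ⟨hu, hu'⟩ w ⟨hw, hw'⟩
      exact affinePoint_injective (hrS hu' hw' ((Set.mem_singleton_iff.1 hu).trans
        (Set.mem_singleton_iff.1 hw).symm))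
    exact (hsub.finite.union hS').subset (by rw [Set.sdiff_union_self]; exact Set.subset_union_left)
  filter_upwards [hpre.compl_mem_cofinite] with u hu
  have hgood : ∀ x, r.toMap (affinePoint u) = q.toMap x → x ∉ T ∪ (Set.range affinePoint)ᶜ :=
    fun x hx hxT => hu (Set.mem_preimage.2 (hx ▸ ⟨x, hxT, rfl⟩))
  obtain ⟨x, hx⟩ := h ⟨affinePoint u, rfl⟩
  have hxg := hgood x hx.symm
  rw [Set.mem_union, not_or, Set.notMem_compl_iff] at hxg
  obtain ⟨hxT, y, rfl⟩ := hxg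
  refine ⟨y, hx.symm, fun z hz => affinePoint_injective (hqT ?_ hxT (hz.symm.trans hx.symm))⟩
  exact fun hzT => hgood _ hz (Or.inl hzT)

lemma toMap_affinePoint_eq_iff (r q : ProjLineMorphism n d) (u y : ℂ) :
    r.toMap (affinePoint u) = q.toMap (affinePoint y) ↔
      ∀ i j, eval ![u, 1] (r.coord i) * eval ![y, 1] (q.coord j) =
        eval ![u, 1] (r.coord j) * eval ![y, 1] (q.coord i) :=
  toMap_mk_eq_toMap_mk_iff _ _ _ _

/-- The restriction of a binary form to the affine line `t = 1`. -/
def dehomogenize (f : BinPoly) : Polynomial ℂ := aeval ![Polynomial.X, 1] f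

lemma eval_dehomogenize (f : BinPoly) (u : ℂ) : (dehomogenize f).eval u = eval ![u, 1] f := by
  rw [dehomogenize, eval_aeval_polynomial]
  congr 2
  funext i
  fin_cases i <;> simp

/-- If the image of `r` lies in that of `q`, then `q⁻¹ ∘ r` is a rational map of the line. -/
lemma exists_rational_of_range_subset {r q : ProjLineMorphism n d}
    (hr : ∃ S : Set (ProjSpace 1), S.Finite ∧ Set.InjOn r.toMap Sᶜ)
    (hq : ∃ S : Set (ProjSpace 1), S.Finite ∧ Set.InjOn q.toMap Sᶜ)
    (h : Set.range r.toMap ⊆ Set.range q.toMap) :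
    ∃ α β : Polynomial ℂ, β ≠ 0 ∧ ∀ᶠ u in Filter.cofinite,
      r.toMap (affinePoint u) = q.toMap (affinePoint (α.eval u / β.eval u)) := by
  -- The 2 × 2 minors of the matrix with columns r(u), q(y); they all vanish exactly when the two
  -- points coincide.
  let F : Fin (n + 1) × Fin (n + 1) → Polynomial (Polynomial ℂ) := fun ij =>
    Polynomial.C (dehomogenize (r.coord ij.1)) *
        (dehomogenize (q.coord ij.2)).map Polynomial.C -
      Polynomial.C (dehomogenize (r.coord ij.2)) *
        (dehomogenize (q.coord ij.1)).map Polynomial.C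
  let J := Ideal.span (Set.range F)
  have hF : ∀ u y ij, ((F ij).map (Polynomial.evalRingHom u)).eval y =
      eval ![u, 1] (r.coord ij.1) * eval ![y, 1] (q.coord ij.2) -
        eval ![u, 1] (r.coord ij.2) * eval ![y, 1] (q.coord ij.1) := by
    intro u y ij
    have hid : (Polynomial.evalRingHom u).comp Polynomial.C = RingHom.id ℂ := by
      ext; simp
    simp [F, Polynomial.map_map, hid, eval_dehomogenize]
  have hJ : ∀ u y, (∀ f ∈ J, (f.map (Polynomial.evalRingHom u)).eval y = 0) ↔
      r.toMap (affinePoint u) = q.toMap (affinePoint y) := by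
    intro u y
    rw [toMap_affinePoint_eq_iff]
    constructor
    · intro hf i j
      have := hf (F (i, j)) (Ideal.subset_span ⟨_, rfl⟩)
      rwa [hF, sub_eq_zero] at this
    · intro hc f hf
      have hle : J ≤ RingHom.ker ((Polynomial.evalRingHom y).comp
          (Polynomial.mapRingHom (Polynomial.evalRingHom u))) := by
        refine Ideal.span_le.2 ?_
        rintro _ ⟨ij, rfl⟩
        exact (hF u y ij).trans (sub_eq_zero.2 (hc _ _))
      exact hle hf
  obtain ⟨α, β, hβ, hev⟩ := exists_rational_common_root J (by
    simpa only [hJ] using eventually_existsUnique_affinePoint hr hq h)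
  exact ⟨α, β, hβ, by simpa only [hJ] using hev⟩

/-! ### Lowest terms and comparison of degrees -/

lemma eval_ne_zero_of_isCoprime {α β : Polynomial ℂ} (h : IsCoprime α β) (x : ℂ) :
    (fun i => (![α, β] i).eval x : Fin 2 → ℂ) ≠ 0 := by
  intro h0
  obtain ⟨a, b, hab⟩ := h
  have h1 : α.eval x = 0 := congrFun h0 0
  have h2 : β.eval x = 0 := congrFun h0 1
  have := congrArg (Polynomial.eval x) hab
  rw [Polynomial.eval_add, Polynomial.eval_mul, Polynomial.eval_mul, h1, h2] at this
  simp at this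

/-- A root of `f` would be a parameter x where all coordinates of `p` vanish at the nonzero vector
(α(x), β(x)). -/
lemma isUnit_of_forall_dvd_aeval (p : ProjLineMorphism n d) {α β : Polynomial ℂ}
    (h : IsCoprime α β) {f : Polynomial ℂ} (hf : ∀ i, f ∣ aeval ![α, β] (p.coord i)) :
    IsUnit f := by
  by_contra hunit
  obtain ⟨x, hx⟩ : ∃ x, f.eval x = 0 := by
    by_cases hf0 : f = 0
    · exact ⟨0, by simp [hf0]⟩
    · exact IsAlgClosed.exists_root f fun hd => hunit (Polynomial.isUnit_iff_degree_eq_zero.2 hd)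
  refine p.vec_ne_zero (eval_ne_zero_of_isCoprime h x) (funext fun i => ?_)
  obtain ⟨k, hk⟩ := hf i
  have := congrArg (Polynomial.eval x) hk
  rwa [eval_aeval_polynomial, Polynomial.eval_mul, hx, zero_mul] at this

lemma exists_coeff_aeval_ne_zero (p : ProjLineMorphism n d) {e : ℕ} {a : Fin 2 → Polynomial ℂ}
    (ha : ∀ i, (a i).natDegree ≤ e) (ha' : (fun i => (a i).coeff e) ≠ 0) :
    ∃ i, (aeval a (p.coord i)).coeff (d * e) ≠ 0 := by
  by_contra! hcon
  refine p.vec_ne_zero ha' (funext fun i => ?_)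
  rw [vec, ← (coeff_aeval_of_natDegree_le (p.isHomogeneous i) a ha).2, hcon i, Pi.zero_apply]

/-- On the affine line, `r` is up to a constant the composition of `q` with a rational map
`[α : β]` in lowest terms. -/
lemma exists_aeval_eq {r q : ProjLineMorphism n d}
    (hr : ∃ S : Set (ProjSpace 1), S.Finite ∧ Set.InjOn r.toMap Sᶜ)
    (hq : ∃ S : Set (ProjSpace 1), S.Finite ∧ Set.InjOn q.toMap Sᶜ)
    (h : Set.range r.toMap ⊆ Set.range q.toMap) :
    ∃ (α β : Polynomial ℂ) (c : ℂ), IsCoprime α β ∧ c ≠ 0 ∧ ∀ i,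
      dehomogenize (r.coord i) = Polynomial.C c * aeval ![α, β] (q.coord i) := by
  classical
  obtain ⟨α₀, β₀, hβ₀, hev⟩ := exists_rational_of_range_subset hr hq h
  have hg : gcd α₀ β₀ ≠ 0 := fun h0 => hβ₀ ((gcd_eq_zero_iff _ _).1 h0).2
  set α := α₀ / gcd α₀ β₀
  set β := β₀ / gcd α₀ β₀
  have hαβ : IsCoprime α β := isCoprime_div_gcd_div_gcd hβ₀
  have hα : α₀ = gcd α₀ β₀ * α := (EuclideanDomain.mul_div_cancel' hg (gcd_dvd_left _ _)).symm
  have hβ : β₀ = gcd α₀ β₀ * β := (EuclideanDomain.mul_div_cancel' hg (gcd_dvd_right _ _)).symm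
  have hcross : ∀ i j, dehomogenize (r.coord i) * aeval ![α, β] (q.coord j) =
      dehomogenize (r.coord j) * aeval ![α, β] (q.coord i) := by
    intro i j
    refine Polynomial.eq_of_infinite_eval_eq _ _ (Filter.frequently_cofinite_iff_infinite.1
      (Filter.Eventually.frequently ?_))
    filter_upwards [hev, eventually_cofinite_eval_ne_zero hβ₀] with u hu hβu
    have hquot : α₀.eval u / β₀.eval u = α.eval u / β.eval u := by
      rw [hβ, Polynomial.eval_mul] at hβu
      rw [congrArg (Polynomial.eval u) hα, congrArg (Polynomial.eval u) hβ, Polynomial.eval_mul,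
        Polynomial.eval_mul, mul_div_mul_left _ _ (left_ne_zero_of_mul hβu)]
    have hβ0 : β.eval u ≠ 0 := by
      rw [hβ, Polynomial.eval_mul] at hβu
      exact right_ne_zero_of_mul hβu
    rw [hquot, toMap_affinePoint_eq_iff] at hu
    have hvec : (fun i => (![α, β] i).eval u) = β.eval u • ![α.eval u / β.eval u, 1] := by
      funext i
      fin_cases i
      · simp
        field_simp
      · simp
    have hq' : ∀ k, (aeval ![α, β] (q.coord k)).eval u =
        β.eval u ^ d * eval ![α.eval u / β.eval u, 1] (q.coord k) := by
      intro k
      rw [eval_aeval_polynomial, hvec]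
      exact congrFun (q.vec_smul _ _) k
    simp only [Polynomial.eval_mul, eval_dehomogenize, hq']
    linear_combination (β.eval u) ^ d * hu i j
  obtain ⟨c, hc⟩ := exists_eq_mul_of_cross_mul_eq
    (fun f hf => q.isUnit_of_forall_dvd_aeval hαβ hf) hcross
  -- The restriction of `r` to t = 1 is its composition with the coprime pair (X, 1), so it too has
  -- no common factor.
  have hcu : IsUnit c := r.isUnit_of_forall_dvd_aeval isCoprime_one_right
    fun i => (⟨_, hc i⟩ : c ∣ dehomogenize (r.coord i))
  obtain ⟨c', hc', rfl⟩ := Polynomial.isUnit_iff.1 hcu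
  exact ⟨α, β, c', hαβ, hc'.ne_zero, hc⟩

/-- Two generically injective parameterizations of the same curve by forms of the same positive
degree differ by an automorphism of the projective line. -/
theorem exists_eq_substForm_of_range_subset (hd : d ≠ 0) {r q : ProjLineMorphism n d}
    (hr : ∃ S : Set (ProjSpace 1), S.Finite ∧ Set.InjOn r.toMap Sᶜ)
    (hq : ∃ S : Set (ProjSpace 1), S.Finite ∧ Set.InjOn q.toMap Sᶜ)
    (h : Set.range r.toMap ⊆ Set.range q.toMap) :
    ∃ (A : GL (Fin 2) ℂ) (c : ℂ), c ≠ 0 ∧ ∀ i, r.coord i = C c * substForm A (q.coord i) := by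
  obtain ⟨α, β, c, hαβ, hc, heq⟩ := exists_aeval_eq hr hq h
  set e := max α.natDegree β.natDegree with he
  have hle : ∀ i, (![α, β] i).natDegree ≤ e := by
    intro i
    fin_cases i
    · exact le_max_left _ _
    · exact le_max_right _ _
  have htop : (fun i => (![α, β] i).coeff e) ≠ 0 := by
    intro h0
    have h1 : α.coeff e = 0 := congrFun h0 0
    have h2 : β.coeff e = 0 := congrFun h0 1
    have hα : α = 0 ∨ β.natDegree = e ∧ α.natDegree < e := by
      by_cases hα : α = 0
      · exact Or.inl hα
      · have : α.natDegree ≠ e := fun h => hα (by rwa [← h, Polynomial.coeff_natDegree,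
          Polynomial.leadingCoeff_eq_zero] at h1)
        have := hle 0
        simp at this
        refine Or.inr ⟨?_, ?_⟩ <;> omega
    have hβ : β = 0 := by
      by_contra hβ
      have h3 : β.natDegree ≠ e := fun h => hβ (by rwa [← h, Polynomial.coeff_natDegree,
          Polynomial.leadingCoeff_eq_zero] at h2)
      rcases hα with rfl | hα
      · simp [he] at h3
      · exact h3 hα.1
    subst hβ
    rcases hα with rfl | hα
    · exact not_isCoprime_zero_zero hαβ
    · simp at hα
      omega
  have hX : ∀ i, (![Polynomial.X, 1] i : Polynomial ℂ).natDegree ≤ 1 := by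
    intro i
    fin_cases i <;> simp
  have hX' : (fun i => (![Polynomial.X, 1] i : Polynomial ℂ).coeff 1) ≠ 0 := fun h0 => by
    simpa using congrFun h0 0
  -- The coordinates of `r` on t = 1 have maximal degree exactly d · 1, those of `q` composed with
  -- (α, β) exactly d · e.
  have he1 : e = 1 := by
    obtain ⟨i, hi⟩ := r.exists_coeff_aeval_ne_zero hX hX'
    obtain ⟨j, hj⟩ := q.exists_coeff_aeval_ne_zero hle htop
    have h1 := Polynomial.le_natDegree_of_ne_zero hi
    have h2 := Polynomial.le_natDegree_of_ne_zero hj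
    have h3 := (coeff_aeval_of_natDegree_le (r.isHomogeneous j) _ hX).1
    have h4 := (coeff_aeval_of_natDegree_le (q.isHomogeneous i) _ hle).1
    have e1 := congrArg Polynomial.natDegree (heq i)
    have e2 := congrArg Polynomial.natDegree (heq j)
    rw [Polynomial.natDegree_C_mul hc] at e1 e2
    rw [dehomogenize] at e1 e2
    have h5 : d * 1 ≤ d * e := by omega
    have h6 : d * e ≤ d * 1 := by omega
    exact (Nat.eq_of_mul_eq_mul_left (Nat.pos_of_ne_zero hd) (le_antisymm h5 h6)).symm
  rw [he1] at hle htop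
  let M : Matrix (Fin 2) (Fin 2) ℂ := Matrix.of fun i => ![(![α, β] i).coeff 1, (![α, β] i).coeff 0]
  have hMeval : ∀ i u, (![α, β] i).eval u = M.mulVec ![u, 1] i := by
    intro i u
    conv_lhs => rw [Polynomial.eq_X_add_C_of_natDegree_le_one (hle i)]
    simp [M, Matrix.mulVec, dotProduct]
  -- A kernel vector at infinity would kill both coefficients of degree 1; any other would give a
  -- common root of α and β.
  have hdet : M.det ≠ 0 := by
    intro h0
    obtain ⟨w, hw, hMw⟩ := Matrix.exists_mulVec_eq_zero_iff.2 h0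
    by_cases hw1 : w 1 = 0
    · have hw0 : w 0 ≠ 0 := fun hw0 => hw (by ext i; fin_cases i <;> simp [hw0, hw1])
      refine htop (funext fun i => ?_)
      have := congrFun hMw i
      simpa [M, Matrix.mulVec, dotProduct, hw1, hw0] using this
    · have hz : ∀ i, (![α, β] i).eval (w 0 / w 1) = 0 := by
        intro i
        have hw' : ![w 0 / w 1, 1] = (w 1)⁻¹ • w := by
          funext k
          fin_cases k <;> simp [hw1, div_eq_inv_mul]
        rw [hMeval, hw', Matrix.mulVec_smul, hMw]
        simp
      exact eval_ne_zero_of_isCoprime hαβ _ (funext hz)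
  refine ⟨Matrix.GeneralLinearGroup.mkOfDetNeZero M hdet, c, hc, fun i => ?_⟩
  refine eq_of_forall_eval_eq fun v hv1 => ?_
  have hv : v = v 1 • ![v 0 / v 1, 1] := by
    funext k
    fin_cases k <;> simp [mul_div_cancel₀, hv1]
  have hval := congrArg (Polynomial.eval (v 0 / v 1)) (heq i)
  rw [eval_dehomogenize, Polynomial.eval_mul, Polynomial.eval_C, eval_aeval_polynomial,
    funext fun i => hMeval i (v 0 / v 1)] at hval
  rw [map_mul, eval_C, eval_substForm, hv, smul_comm]
  have h1 := congrFun (r.vec_smul (v 1) ![v 0 / v 1, 1]) i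
  have h2 := congrFun (q.vec_smul (v 1) (M.mulVec ![v 0 / v 1, 1])) i
  simp only [vec, Pi.smul_apply, smul_eq_mul] at h1 h2
  rw [h1, hval]
  refine Eq.trans ?_ (congrArg (c * ·) h2.symm)
  ring

end ProjLineMorphism

/-! ### Scaled coefficients and derivatives of binary forms -/

lemma factorial_mul_coeff_iterate_pderiv (i : Fin 2) (k : ℕ) (f : BinPoly) (m : Fin 2 →₀ ℕ) :
    ((m i).factorial : ℂ) * coeff m ((pderiv i)^[k] f) =
      (m i + k).factorial * coeff (m + Finsupp.single i k) f := by
  induction k generalizing f with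
  | zero => simp
  | succ k ih =>
    rw [Function.iterate_succ_apply, ih, coeff_pderiv, add_assoc, ← Finsupp.single_add, ← add_assoc,
      Nat.factorial_succ, Finsupp.add_apply, Finsupp.single_eq_same]
    push_cast
    ring

/-- The exponent of the monomial `sᵃ tᵇ`. -/
def binExponent (a b : ℕ) : Fin 2 →₀ ℕ := Finsupp.single 0 a + Finsupp.single 1 b

lemma eq_binExponent (m : Fin 2 →₀ ℕ) : m = binExponent (m 0) (m 1) := by
  ext i
  fin_cases i <;> simp [binExponent]

lemma binExponent_inj {a b a' b' : ℕ} : binExponent a b = binExponent a' b' ↔ a = a' ∧ b = b' := by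
  constructor
  · intro h
    exact ⟨by simpa [binExponent] using DFunLike.congr_fun h 0,
      by simpa [binExponent] using DFunLike.congr_fun h 1⟩
  · rintro ⟨rfl, rfl⟩
    rfl

lemma coeff_binExponent_eq_zero {d a b : ℕ} {f : BinPoly} (hf : f.IsHomogeneous d)
    (h : a + b ≠ d) : coeff (binExponent a b) f = 0 := by
  refine hf.coeff_eq_zero ?_
  simpa [binExponent, Finsupp.degree_eq_sum] using h

/-- The coefficients of a binary form of degree `N`, in the basis
`sᴺ⁻ʲ tʲ / ((N - j)! j!)`. -/
def scaledCoeff (N : ℕ) : BinPoly →ₗ[ℂ] (Fin (N + 1) → ℂ) where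
  toFun f j := (N - (j : ℕ)).factorial * (j : ℕ).factorial * coeff (binExponent (N - j) j) f
  map_add' f g := by
    funext j
    simp [mul_add]
  map_smul' c f := by
    funext j
    simp
    ring

lemma scaledCoeff_apply (N : ℕ) (f : BinPoly) (j : Fin (N + 1)) : scaledCoeff N f j =
    (N - (j : ℕ)).factorial * (j : ℕ).factorial * coeff (binExponent (N - j) j) f := rfl

lemma eq_zero_of_scaledCoeff_eq_zero {N : ℕ} {f : BinPoly} (hf : f.IsHomogeneous N)
    (h : scaledCoeff N f = 0) : f = 0 := by
  ext m
  rw [eq_binExponent m, coeff_zero]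
  by_cases hm : m 0 + m 1 = N
  · have h1 := congrFun h ⟨m 1, by omega⟩
    rw [scaledCoeff_apply, Pi.zero_apply, Fin.val_mk, show N - m 1 = m 0 by omega] at h1
    exact (mul_eq_zero.1 h1).resolve_left
      (mul_ne_zero (Nat.cast_ne_zero.2 (Nat.factorial_ne_zero _))
        (Nat.cast_ne_zero.2 (Nat.factorial_ne_zero _)))
  · exact coeff_binExponent_eq_zero hf hm

lemma exists_scaledCoeff_eq {N : ℕ} (b : Fin (N + 1) → ℂ) :
    ∃ f : BinPoly, f.IsHomogeneous N ∧ scaledCoeff N f = b := by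
  refine ⟨∑ j : Fin (N + 1), monomial (binExponent (N - j) j)
    (b j / ((N - (j : ℕ)).factorial * (j : ℕ).factorial)),
    IsHomogeneous.sum _ _ _ fun j _ => isHomogeneous_monomial _ ?_, funext fun k => ?_⟩
  · have := j.2
    simp [binExponent, Finsupp.degree_eq_sum]
    omega
  · rw [scaledCoeff_apply, coeff_sum, Finset.sum_eq_single k]
    · rw [coeff_monomial, if_pos rfl]
      have h1 : ((N - (k : ℕ)).factorial : ℂ) ≠ 0 := Nat.cast_ne_zero.2 (Nat.factorial_ne_zero _)
      have h2 : ((k : ℕ).factorial : ℂ) ≠ 0 := Nat.cast_ne_zero.2 (Nat.factorial_ne_zero _)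
      field_simp
    · intro j _ hjk
      rw [coeff_monomial, if_neg]
      rw [binExponent_inj]
      exact fun h => hjk (Fin.ext h.2)
    · simp

/-- The partial derivatives of order `n` of a form of degree `n + 1`. -/
lemma iterate_pderiv_eq {n : ℕ} {f : BinPoly} (hf : f.IsHomogeneous (n + 1)) (k : Fin (n + 1)) :
    (pderiv (0 : Fin 2))^[n - (k : ℕ)] ((pderiv (1 : Fin 2))^[(k : ℕ)] f) =
      C (scaledCoeff (n + 1) f k.castSucc) * X 0 + C (scaledCoeff (n + 1) f k.succ) * X 1 := by
  ext m
  have hk := k.2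
  have hX0 : (X 0 : BinPoly) = monomial (binExponent 1 0) 1 := by simp [binExponent, X]
  have hX1 : (X 1 : BinPoly) = monomial (binExponent 0 1) 1 := by simp [binExponent, X]
  obtain ⟨a, b, rfl⟩ : ∃ a b, m = binExponent a b := ⟨_, _, eq_binExponent m⟩
  have h0 := factorial_mul_coeff_iterate_pderiv 0 (n - k) ((pderiv (1 : Fin 2))^[(k : ℕ)] f)
    (binExponent a b)
  have h1 := factorial_mul_coeff_iterate_pderiv 1 k f (binExponent (a + (n - k)) b)
  have e0 : binExponent a b + Finsupp.single 0 (n - (k : ℕ)) = binExponent (a + (n - k)) b := by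
    simp [binExponent, Finsupp.single_add, add_right_comm]
  have e1 : binExponent (a + (n - k)) b + Finsupp.single 1 (k : ℕ) =
      binExponent (a + (n - k)) (b + k) := by
    simp [binExponent, Finsupp.single_add, add_assoc]
  rw [e0] at h0
  rw [e1] at h1
  simp only [binExponent, Finsupp.add_apply, Finsupp.single_eq_same, ne_eq, one_ne_zero,
    zero_ne_one, not_false_eq_true, Finsupp.single_eq_of_ne, add_zero, zero_add] at h0 h1
  simp only [← binExponent.eq_def] at h0 h1
  have ha : (a.factorial : ℂ) ≠ 0 := Nat.cast_ne_zero.2 (Nat.factorial_ne_zero _)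
  have hb : (b.factorial : ℂ) ≠ 0 := Nat.cast_ne_zero.2 (Nat.factorial_ne_zero _)
  rw [coeff_add, coeff_C_mul, coeff_C_mul, hX0, hX1, coeff_monomial, coeff_monomial]
  simp only [binExponent_inj]
  by_cases hab : a + b = 1
  · obtain ⟨rfl, rfl⟩ | ⟨rfl, rfl⟩ : (a = 1 ∧ b = 0) ∨ (a = 0 ∧ b = 1) := by omega
    · rw [scaledCoeff_apply]
      simp only [Fin.val_castSucc, show n + 1 - (k : ℕ) = 1 + (n - k) by omega]
      simp at h0 h1 ⊢
      rw [h0, h1]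
      ring
    · rw [scaledCoeff_apply, scaledCoeff_apply]
      simp only [Fin.val_succ, show n + 1 - ((k : ℕ) + 1) = n - k by omega]
      simp [add_comm 1] at h0 h1 ⊢
      rw [h0, h1]
      ring
  · have hz : coeff (binExponent (a + (n - k)) (b + k)) f = 0 :=
      coeff_binExponent_eq_zero hf (by omega)
    rw [hz, mul_zero] at h1
    rw [(mul_eq_zero.1 h1).resolve_left hb, mul_zero] at h0
    rw [(mul_eq_zero.1 h0).resolve_left ha, if_neg (by omega), if_neg (by omega)]
    simp

/-! ### Powers of linear forms -/

/-- The linear form vanishing at `v`. -/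
def linearForm (v : Fin 2 → ℂ) : BinPoly := C (v 1) * X 0 - C (v 0) * X 1

lemma isHomogeneous_linearForm (v : Fin 2 → ℂ) : (linearForm v).IsHomogeneous 1 :=
  (isHomogeneous_C_mul_X _ _).sub (isHomogeneous_C_mul_X _ _)

lemma isHomogeneous_linearForm_pow (v : Fin 2 → ℂ) (N : ℕ) :
    (linearForm v ^ N).IsHomogeneous N := by
  simpa using (isHomogeneous_linearForm v).pow N

lemma linearForm_pow_eq_sum (v : Fin 2 → ℂ) (N : ℕ) : linearForm v ^ N =
    ∑ j ∈ Finset.range (N + 1),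
      monomial (binExponent (N - j) j) (v 1 ^ (N - j) * (-v 0) ^ j * (N.choose j : ℂ)) := by
  have : linearForm v = C (-v 0) * X 1 + C (v 1) * X 0 := by
    simp [linearForm]
    ring
  rw [this, add_pow]
  refine Finset.sum_congr rfl fun j _ => ?_
  rw [mul_pow, mul_pow, ← C_pow, ← C_pow, X_pow_eq_monomial, X_pow_eq_monomial, C_mul_monomial,
    C_mul_monomial, monomial_mul, ← map_natCast (C : ℂ →+* BinPoly), mul_comm _ (C _),
    C_mul_monomial, binExponent, add_comm (Finsupp.single 1 _)]
  congr 1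
  ring

/-- The factorials in `scaledCoeff` absorb the binomial coefficients: (N − j)! j! · (N choose j) =
N!. -/
lemma scaledCoeff_linearForm_pow (v : Fin 2 → ℂ) (N : ℕ) : scaledCoeff N (linearForm v ^ N) =
    (N.factorial : ℂ) • fun j : Fin (N + 1) => v 1 ^ (N - (j : ℕ)) * (-v 0) ^ (j : ℕ) := by
  funext j
  have hj : (j : ℕ) ≤ N := Nat.lt_succ_iff.1 j.2
  rw [scaledCoeff_apply, linearForm_pow_eq_sum, coeff_sum, Finset.sum_eq_single (j : ℕ)]
  · rw [coeff_monomial, if_pos rfl, Pi.smul_apply, smul_eq_mul,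
      ← Nat.choose_mul_factorial_mul_factorial hj]
    push_cast
    ring
  · intro i _ hij
    rw [coeff_monomial, if_neg]
    rw [binExponent_inj]
    exact fun h => hij h.2
  · intro h
    exact absurd (Finset.mem_range.2 j.2) h

/-- A linear functional that vanishes on the `N`-th powers of linear forms vanishes on all forms
of degree `N`. -/
lemma eq_zero_of_forall_linearForm_pow {N : ℕ} (l : BinPoly →ₗ[ℂ] ℂ)
    (h : ∀ v, l (linearForm v ^ N) = 0) {f : BinPoly} (hf : f.IsHomogeneous N) : l f = 0 := by
  -- P(x) is the value of `l` on (s + x t)ᴺ. It vanishes for all x, hence so does each coefficient,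
  -- which is a nonzero multiple of `l` on a monomial.
  let P : Polynomial ℂ := ∑ j ∈ Finset.range (N + 1),
    Polynomial.monomial j ((N.choose j : ℂ) * l (monomial (binExponent (N - j) j) 1))
  have hP : P = 0 := by
    refine Polynomial.funext fun x => ?_
    have := h ![-x, 1]
    rw [linearForm_pow_eq_sum, map_sum] at this
    rw [Polynomial.eval_finsetSum, Polynomial.eval_zero, ← this]
    refine Finset.sum_congr rfl fun j _ => ?_
    have e : monomial (binExponent (N - j) j) (x ^ j * (N.choose j : ℂ)) =
        (x ^ j * (N.choose j : ℂ)) • monomial (R := ℂ) (binExponent (N - j) j) 1 := by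
      rw [smul_monomial, smul_eq_mul, mul_one]
    simp only [Matrix.cons_val_one, Matrix.cons_val_zero, Matrix.cons_val_fin_one, one_pow, one_mul,
      neg_neg]
    rw [e, map_smul, smul_eq_mul, Polynomial.eval_monomial]
    ring
  have hmon : ∀ j ≤ N, l (monomial (binExponent (N - j) j) 1) = 0 := by
    intro j hj
    have := congrArg (Polynomial.coeff · j) hP
    simp only [P, Polynomial.finsetSum_coeff, Polynomial.coeff_monomial, Polynomial.coeff_zero,
      Finset.sum_ite_eq', Finset.mem_range, if_pos (Nat.lt_succ_of_le hj)] at this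
    exact (mul_eq_zero.1 this).resolve_left
      (Nat.cast_ne_zero.2 (Nat.choose_pos hj).ne')
  rw [f.as_sum, map_sum]
  refine Finset.sum_eq_zero fun m hm => ?_
  have hd : m 0 + m 1 = N := by
    by_contra hne
    rw [mem_support_iff, eq_binExponent m] at hm
    exact hm (coeff_binExponent_eq_zero hf hne)
  have e : monomial m (coeff m f) =
      coeff m f • monomial (R := ℂ) (binExponent (N - m 1) (m 1)) 1 := by
    rw [smul_monomial, smul_eq_mul, mul_one, show N - m 1 = m 0 by omega, ← eq_binExponent]
  rw [e, map_smul, hmon _ (by omega), smul_zero]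

/-! ### The bordered determinant -/

/-- The matrix `a` with a further row `b`. -/
def snocRow {R : Type*} {N : ℕ} (a : Fin N → Fin (N + 1) → R) (b : Fin (N + 1) → R) :
    Matrix (Fin (N + 1)) (Fin (N + 1)) R :=
  Matrix.of (Fin.snoc (α := fun _ => Fin (N + 1) → R) a b)

/-- Multiply on the right by the lower triangular `T`, which replaces column k by x · (column k) + y
· (column k + 1) and keeps the last column. The last row becomes (0, …, 0, (−x)ᴺ), and expansion
along it leaves the determinant on the right. -/
lemma pow_mul_det_snocRow {R : Type*} [CommRing R] {N : ℕ} (a : Fin N → Fin (N + 1) → R)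
    (x y : R) :
    (snocRow a fun j => y ^ (N - (j : ℕ)) * (-x) ^ (j : ℕ)).det * x ^ N =
      (-x) ^ N * (Matrix.of fun i k : Fin N => a i k.castSucc * x + a i k.succ * y).det := by
  let T : Matrix (Fin (N + 1)) (Fin (N + 1)) R := Matrix.of fun i =>
    Fin.snoc (α := fun _ => R)
      (fun k : Fin N => (if i = k.castSucc then x else 0) + if i = k.succ then y else 0)
      (if i = Fin.last N then 1 else 0)
  have hT : T.det = x ^ N := by
    rw [Matrix.det_of_isLowerTriangular, Fin.prod_univ_castSucc]
    · simp [T, (Fin.castSucc_lt_succ).ne]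
    · intro i k hik
      rw [OrderDual.toDual_lt_toDual] at hik
      induction k using Fin.lastCases with
      | last => simp [T, hik.ne]
      | cast k => simp [T, hik.ne, (hik.trans Fin.castSucc_lt_succ).ne]
  have hsum : ∀ (c : Fin (N + 1) → R) (k : Fin N),
      ∑ j, c j * T j k.castSucc = c k.castSucc * x + c k.succ * y := by
    intro c k
    simp [T, mul_add, Finset.sum_add_distrib]
  have hlast : ∀ c : Fin (N + 1) → R, ∑ j, c j * T j (Fin.last N) = c (Fin.last N) := by
    intro c
    simp [T]
  rw [← hT, ← Matrix.det_mul, Matrix.det_succ_row _ (Fin.last N), Fin.sum_univ_castSucc,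
    Finset.sum_eq_zero, zero_add]
  · have e1 : (snocRow a (fun j => y ^ (N - (j : ℕ)) * (-x) ^ (j : ℕ)) * T) (Fin.last N)
        (Fin.last N) = (-x) ^ N := by
      rw [Matrix.mul_apply, hlast]
      simp [snocRow]
    have e2 : (snocRow a (fun j => y ^ (N - (j : ℕ)) * (-x) ^ (j : ℕ)) * T).submatrix
        (Fin.last N).succAbove (Fin.last N).succAbove =
        Matrix.of fun i k : Fin N => a i k.castSucc * x + a i k.succ * y := by
      ext i k
      rw [Matrix.submatrix_apply, Fin.succAbove_last, Matrix.mul_apply, hsum]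
      simp [snocRow]
    rw [e1, e2, ← two_mul, pow_mul]
    simp
  · intro k _
    have hk := k.2
    have : (snocRow a (fun j => y ^ (N - (j : ℕ)) * (-x) ^ (j : ℕ)) * T) (Fin.last N)
        k.castSucc = 0 := by
      rw [Matrix.mul_apply, hsum]
      simp only [snocRow, Matrix.of_apply, Fin.snoc_last, Fin.val_castSucc, Fin.val_succ,
        show N - (k : ℕ) = N - (k + 1) + 1 by omega]
      ring
    rw [this]
    simp

/-- The factor xᴺ is cancelled with x and y as indeterminates, since the number x may be zero. -/
lemma det_snocRow_eq {N : ℕ} (a : Fin N → Fin (N + 1) → ℂ) (x y : ℂ) :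
    (snocRow a fun j => y ^ (N - (j : ℕ)) * (-x) ^ (j : ℕ)).det =
      (-1) ^ N * (Matrix.of fun i k : Fin N => a i k.castSucc * x + a i k.succ * y).det := by
  have h := pow_mul_det_snocRow (fun i j => (C (a i j) : BinPoly)) (X 0) (X 1)
  rw [neg_pow (X 0 : BinPoly), mul_right_comm] at h
  have h' := congrArg (eval ![x, y])
    (mul_right_cancel₀ (pow_ne_zero N (X_ne_zero (R := ℂ) (0 : Fin 2))) h)
  rw [map_mul, RingHom.map_det, RingHom.map_det] at h'
  convert h' using 2
  · ext i j
    induction i using Fin.lastCases <;> simp [snocRow]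
  · simp
  · congr 1
    ext i j
    simp

lemma exists_mul_eq_of_forall_eq_zero {E : Type*} [AddCommGroup E] [Module ℂ E]
    (V : Submodule ℂ E) (l₁ l₂ : E →ₗ[ℂ] ℂ) (h : ∀ g ∈ V, l₁ g = 0 → l₂ g = 0) :
    ∃ μ : ℂ, ∀ g ∈ V, μ * l₁ g = l₂ g := by
  have hker : ⨅ _ : Unit, (l₁.comp V.subtype).ker ≤ (l₂.comp V.subtype).ker := by
    rw [iInf_const]
    exact fun g hg => h g g.2 hg
  have hmem := mem_span_of_iInf_ker_le_ker (L := fun _ : Unit => l₁.comp V.subtype) hker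
  rw [Set.range_const, Submodule.mem_span_singleton] at hmem
  obtain ⟨μ, hμ⟩ := hmem
  exact ⟨μ, fun g hg => DFunLike.congr_fun hμ ⟨g, hg⟩⟩

/-! ### The determinant functional and the osculating polynomial -/

/-- The substitution `G ↦ G ∘ A` as an algebra homomorphism. -/
def substHom (A : GL (Fin 2) ℂ) : BinPoly →ₐ[ℂ] BinPoly :=
  aeval (fun i : Fin 2 => ∑ j : Fin 2, C (A i j) * (X j : BinPoly))

lemma substHom_apply (A : GL (Fin 2) ℂ) (G : BinPoly) : substHom A G = substForm A G := rfl

lemma substHom_injective (A : GL (Fin 2) ℂ) : Function.Injective (substHom A) := by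
  intro F G h
  refine MvPolynomial.funext fun v => ?_
  have := congrArg (eval (A⁻¹ • v)) h
  rwa [substHom_apply, substHom_apply, eval_substForm, eval_substForm, smul_inv_smul] at this

/-- The value of `linearForm v` at w is det(w, v), and det(Aw, Av) = det A · det(w, v). -/
lemma substHom_linearForm (A : GL (Fin 2) ℂ) (v : Fin 2 → ℂ) :
    substHom A (linearForm (A • v)) = C A.val.det * linearForm v := by
  refine MvPolynomial.funext fun w => ?_
  rw [substHom_apply, eval_substForm]
  simp only [linearForm, map_mul, map_sub, eval_C, eval_X, Matrix.det_fin_two]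
  simp only [Units.smul_def, Matrix.smul_eq_mulVec, Matrix.mulVec, dotProduct, Fin.sum_univ_two]
  ring

namespace ProjLineMorphism

variable {n : ℕ}

/-- The determinant of `p₀, …, pₙ, f` in the space of binary forms of degree `n + 1`. -/
def detFunctional (p : ProjLineMorphism n (n + 1)) : BinPoly →ₗ[ℂ] ℂ :=
  (Matrix.detRowAlternating.toMultilinearMap.toLinearMap
    (Fin.snoc (α := fun _ => Fin (n + 1 + 1) → ℂ) (fun i => scaledCoeff (n + 1) (p.coord i)) 0)
    (Fin.last (n + 1))).comp (scaledCoeff (n + 1))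

lemma detFunctional_apply (p : ProjLineMorphism n (n + 1)) (f : BinPoly) : p.detFunctional f =
    (snocRow (fun i => scaledCoeff (n + 1) (p.coord i)) (scaledCoeff (n + 1) f)).det := by
  change Matrix.det (Function.update _ _ _) = _
  rw [Fin.update_snoc_last]
  rfl

lemma eval_osculating (p : ProjLineMorphism n (n + 1)) (v : Fin 2 → ℂ) :
    eval v p.osculating = (Matrix.of fun i k : Fin (n + 1) =>
      scaledCoeff (n + 1) (p.coord i) k.castSucc * v 0 +
        scaledCoeff (n + 1) (p.coord i) k.succ * v 1).det := by
  rw [osculating, RingHom.map_det]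
  congr 1
  ext i k
  simp [iterate_pderiv_eq (p.isHomogeneous i)]

/-- The osculating polynomial is the determinant functional on the powers of linear forms. -/
lemma detFunctional_linearForm_pow (p : ProjLineMorphism n (n + 1)) (v : Fin 2 → ℂ) :
    p.detFunctional (linearForm v ^ (n + 1)) =
      (n + 1).factorial * (-1) ^ (n + 1) * eval v p.osculating := by
  obtain ⟨g, -, hg⟩ := exists_scaledCoeff_eq (N := n + 1)
    fun j => v 1 ^ (n + 1 - (j : ℕ)) * (-v 0) ^ (j : ℕ)
  have h : scaledCoeff (n + 1) (linearForm v ^ (n + 1)) =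
      scaledCoeff (n + 1) (((n + 1).factorial : ℂ) • g) := by
    rw [scaledCoeff_linearForm_pow, map_smul, hg]
  rw [detFunctional_apply, h, ← detFunctional_apply, map_smul, detFunctional_apply, hg,
    det_snocRow_eq, eval_osculating, smul_eq_mul, mul_assoc]

/-- `scaledCoeff` is injective only on forms of the right degree, and the span of the coordinates
consists of such forms. -/
lemma linearIndependent_scaledCoeff (p : ProjLineMorphism n (n + 1))
    (hp : LinearIndependent ℂ p.coord) :
    LinearIndependent ℂ fun i => scaledCoeff (n + 1) (p.coord i) := by
  refine hp.map_injOn (scaledCoeff (n + 1)) fun f hf g hg h => ?_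
  have hle : Submodule.span ℂ (Set.range p.coord) ≤ homogeneousSubmodule (Fin 2) ℂ (n + 1) :=
    Submodule.span_le.2 (by rintro _ ⟨i, rfl⟩; exact p.isHomogeneous i)
  refine sub_eq_zero.1 (eq_zero_of_scaledCoeff_eq_zero ((hle hf).sub (hle hg)) ?_)
  rw [map_sub, h, sub_self]

lemma detFunctional_eq_zero_iff (p : ProjLineMorphism n (n + 1))
    (hp : LinearIndependent ℂ p.coord) {f : BinPoly} (hf : f.IsHomogeneous (n + 1)) :
    p.detFunctional f = 0 ↔ f ∈ Submodule.span ℂ (Set.range p.coord) := by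
  have h1 : p.detFunctional f ≠ 0 ↔ LinearIndependent ℂ
      (Fin.snoc (α := fun _ => Fin (n + 1 + 1) → ℂ)
        (fun i => scaledCoeff (n + 1) (p.coord i)) (scaledCoeff (n + 1) f)) := by
    rw [detFunctional_apply, ← isUnit_iff_ne_zero, ← Matrix.isUnit_iff_isUnit_det,
      ← Matrix.linearIndependent_rows_iff_isUnit]
    rfl
  rw [← not_iff_not, ← ne_eq, h1, linearIndependent_finSnoc,
    and_iff_right (p.linearIndependent_scaledCoeff hp), not_iff_not]
  rw [show (Set.range fun i => scaledCoeff (n + 1) (p.coord i)) =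
    scaledCoeff (n + 1) '' Set.range p.coord from Set.range_comp _ _, ← Submodule.map_span]
  constructor
  · rintro ⟨g, hg, hgf⟩
    have hle : Submodule.span ℂ (Set.range p.coord) ≤ homogeneousSubmodule (Fin 2) ℂ (n + 1) :=
      Submodule.span_le.2 (by rintro _ ⟨i, rfl⟩; exact p.isHomogeneous i)
    have := eq_zero_of_scaledCoeff_eq_zero ((hle hg).sub hf) (by rw [map_sub, hgf, sub_self])
    rwa [← sub_eq_zero.1 this]
  · exact fun h => Submodule.mem_map_of_mem h

lemma exists_detFunctional_ne_zero (p : ProjLineMorphism n (n + 1))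
    (hp : LinearIndependent ℂ p.coord) :
    ∃ f : BinPoly, f.IsHomogeneous (n + 1) ∧ p.detFunctional f ≠ 0 := by
  obtain ⟨b, hb⟩ := exists_linearIndependent_snoc_of_lt_finrank
    (p.linearIndependent_scaledCoeff hp) (by simp)
  obtain ⟨f, hf, rfl⟩ := exists_scaledCoeff_eq b
  refine ⟨f, hf, ?_⟩
  rw [detFunctional_apply, ← isUnit_iff_ne_zero, ← Matrix.isUnit_iff_isUnit_det,
    ← Matrix.linearIndependent_rows_iff_isUnit]
  exact hb

lemma detFunctional_substHom_linearForm_pow (p : ProjLineMorphism n (n + 1)) (A : GL (Fin 2) ℂ)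
    (v : Fin 2 → ℂ) : p.detFunctional (substHom A (linearForm (A • v) ^ (n + 1))) =
      A.val.det ^ (n + 1) * p.detFunctional (linearForm v ^ (n + 1)) := by
  rw [map_pow, substHom_linearForm, mul_pow, ← C_pow, ← smul_eq_C_mul, map_smul, smul_eq_mul]

/-- The forms `q ∘ A` lie in the span of the forms `p` if and only if `A` carries the osculating
polynomial of `p` to that of `q`. -/
theorem substForm_mem_span_iff (p q : ProjLineMorphism n (n + 1))
    (hp : LinearIndependent ℂ p.coord) (hq : LinearIndependent ℂ q.coord) (A : GL (Fin 2) ℂ) :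
    (∀ i, substForm A (q.coord i) ∈ Submodule.span ℂ (Set.range p.coord)) ↔
      ∃ μ : ℂ, μ ≠ 0 ∧ substForm A q.osculating = C μ * p.osculating := by
  have hA : A.val.det ≠ 0 := ((Matrix.isUnit_iff_isUnit_det _).1 A.isUnit).ne_zero
  have hk : ((n + 1).factorial * (-1) ^ (n + 1) : ℂ) ≠ 0 :=
    mul_ne_zero (Nat.cast_ne_zero.2 (Nat.factorial_ne_zero _)) (pow_ne_zero _ (by norm_num))
  have hA' := pow_ne_zero (n + 1) hA
  constructor
  · intro h
    -- The kernel of `q.detFunctional` on forms is the span of the qᵢ, on which `p.detFunctional`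
    -- after substitution vanishes; hence the two functionals are proportional.
    obtain ⟨μ, hμ'⟩ := exists_mul_eq_of_forall_eq_zero (homogeneousSubmodule (Fin 2) ℂ (n + 1))
      q.detFunctional (p.detFunctional.comp (substHom A).toLinearMap) (by
        intro g hg hg'
        refine (p.detFunctional_eq_zero_iff hp (isHomogeneous_substForm A hg)).2 ?_
        have hle : Submodule.span ℂ (Set.range q.coord) ≤
            (Submodule.span ℂ (Set.range p.coord)).comap (substHom A).toLinearMap :=
          Submodule.span_le.2 (by rintro _ ⟨i, rfl⟩; exact h i)
        exact hle ((q.detFunctional_eq_zero_iff hq hg).1 hg'))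
    simp only [LinearMap.comp_apply, AlgHom.toLinearMap_apply] at hμ'
    have hμ0 : μ ≠ 0 := by
      rintro rfl
      obtain ⟨f, hf, hf0⟩ := p.exists_detFunctional_ne_zero hp
      refine hf0 ?_
      have := hμ' (substForm A⁻¹ f) (isHomogeneous_substForm _ hf)
      have e : substHom A (substForm A⁻¹ f) = f := by
        refine MvPolynomial.funext fun v => ?_
        rw [substHom_apply, eval_substForm, eval_substForm, inv_smul_smul]
      rw [← e, ← this, zero_mul]
    -- Evaluating both functionals on the power of the linear form at `A • v` gives μ Δ_q(Av) = (det
    -- A)ⁿ⁺¹ Δ_p(v).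
    refine ⟨A.val.det ^ (n + 1) / μ, div_ne_zero hA' hμ0, MvPolynomial.funext fun v => ?_⟩
    have h1 := hμ' _ (isHomogeneous_linearForm_pow (A • v) (n + 1))
    rw [detFunctional_substHom_linearForm_pow, detFunctional_linearForm_pow,
      detFunctional_linearForm_pow] at h1
    rw [eval_substForm, map_mul, eval_C]
    refine mul_left_cancel₀ (mul_ne_zero hμ0 hk) ?_
    rw [div_mul_eq_mul_div, mul_assoc, h1]
    field_simp
  · rintro ⟨μ, hμ, h⟩ i
    -- Proportional osculating polynomials make the functionals proportional on powers of linear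
    -- forms, hence on all forms. Applied to qᵢ, which `q.detFunctional` kills, this puts qᵢ ∘ A in
    -- the kernel of `p.detFunctional`.
    have hl : ∀ w, (q.detFunctional - (μ / A.val.det ^ (n + 1)) •
        p.detFunctional.comp (substHom A).toLinearMap) (linearForm w ^ (n + 1)) = 0 := by
      intro w
      obtain ⟨v, rfl⟩ : ∃ v, w = A • v := ⟨A⁻¹ • w, (smul_inv_smul A w).symm⟩
      have h1 := congrArg (eval v) h
      rw [eval_substForm, map_mul, eval_C] at h1
      rw [LinearMap.sub_apply, LinearMap.smul_apply, LinearMap.comp_apply, AlgHom.toLinearMap_apply,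
        detFunctional_substHom_linearForm_pow, detFunctional_linearForm_pow,
        detFunctional_linearForm_pow, h1, smul_eq_mul]
      field_simp
      ring
    have h2 := eq_zero_of_forall_linearForm_pow _ hl (q.isHomogeneous i)
    have h3 : q.detFunctional (q.coord i) = 0 :=
      (q.detFunctional_eq_zero_iff hq (q.isHomogeneous i)).2 (Submodule.subset_span ⟨i, rfl⟩)
    rw [LinearMap.sub_apply, h3, zero_sub, neg_eq_zero, LinearMap.smul_apply, smul_eq_mul] at h2
    exact (p.detFunctional_eq_zero_iff hp (isHomogeneous_substForm A (q.isHomogeneous i))).1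
      ((mul_eq_zero.1 h2).resolve_left (div_ne_zero hμ hA'))

end ProjLineMorphism

/-! ### Lifting, descent and uniqueness of automorphisms -/

/-- An automorphism of the projective line that fixes almost all points is the identity. -/
lemma projAut_eq_one_of_finite {χ : ProjAut 1} (h : {x : ProjSpace 1 | χ • x ≠ x}.Finite) :
    χ = 1 := by
  induction χ using Matrix.ProjGenLinGroup.induction_on with
  | mk B =>
    have hev : ∀ᶠ u in Filter.cofinite,
        (Matrix.ProjGenLinGroup.mk B : ProjAut 1) • affinePoint u = affinePoint u := by
      rw [Filter.eventually_cofinite]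
      exact h.preimage affinePoint_injective.injOn
    -- P(u) = 0 is the fixed point equation of [u : 1]; its coefficients vanish only for scalar
    -- matrices.
    let P : Polynomial ℂ := Polynomial.C (B 0 0 - B 1 1) * Polynomial.X + Polynomial.C (B 0 1) -
      Polynomial.C (B 1 0) * Polynomial.X ^ 2
    have hP : P = 0 := by
      refine Polynomial.eq_of_infinite_eval_eq _ _ (Filter.frequently_cofinite_iff_infinite.1
        (Filter.Eventually.frequently ?_))
      filter_upwards [hev] with u hu
      rw [affinePoint, mk_smul_mk, projectivization_mk_eq_mk_iff_cross] at hu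
      have e : ∀ i, (B • ![u, 1]) i = B i 0 * u + B i 1 := fun i => by
        change Matrix.mulVec (B : Matrix (Fin 2) (Fin 2) ℂ) ![u, 1] i = _
        simp [Matrix.mulVec, dotProduct]
      have : (B 0 0 * u + B 0 1) * 1 = (B 1 0 * u + B 1 1) * u := by
        rw [← e, ← e]
        exact hu 0 1
      simp only [P, Polynomial.eval_sub, Polynomial.eval_add, Polynomial.eval_mul,
        Polynomial.eval_C, Polynomial.eval_X, Polynomial.eval_pow, Polynomial.eval_zero]
      linear_combination this
    have h0 : B 0 1 = 0 := by simpa [P] using congrArg (Polynomial.coeff · 0) hP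
    have h1 : B 0 0 - B 1 1 = 0 := by
      simpa [P, Polynomial.coeff_X, Polynomial.coeff_C, -map_sub] using
        congrArg (Polynomial.coeff · 1) hP
    have h2 : B 1 0 = 0 := by
      simpa [P, Polynomial.coeff_X, Polynomial.coeff_C, -map_sub] using
        congrArg (Polynomial.coeff · 2) hP
    have hB : B 0 0 ≠ 0 := by
      intro hB
      have hdet := ((Matrix.isUnit_iff_isUnit_det _).1 B.isUnit).ne_zero
      rw [Matrix.det_fin_two] at hdet
      simp [hB, h0] at hdet
    rw [show B = Matrix.GeneralLinearGroup.scalar (Fin 2) (Units.mk0 _ hB) by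
      ext i j
      fin_cases i <;> fin_cases j
      · simp
      · simpa using h0
      · simpa using h2
      · simpa using (sub_eq_zero.1 h1).symm]
    exact Matrix.ProjGenLinGroup.mk_scalar _

namespace RationalCurve

variable {n d : ℕ}

/-- ψ and ψ' agree wherever both values avoid the exceptional set of `q`, so ψ'⁻¹ψ fixes almost all
points. -/
lemma projAut_eq_of_toMap_smul_eq (q : RationalCurve n d) {ψ ψ' : ProjAut 1}
    (h : ∀ x : ProjSpace 1, q.toMap (ψ • x) = q.toMap (ψ' • x)) : ψ = ψ' := by
  obtain ⟨S, hS, hinj⟩ := q.birational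
  refine (inv_mul_eq_one.1 (projAut_eq_one_of_finite (χ := ψ'⁻¹ * ψ) ?_)).symm
  refine ((hS.preimage (MulAction.injective ψ).injOn).union
    (hS.preimage (MulAction.injective ψ').injOn)).subset fun x hx => ?_
  by_contra hcon
  rw [Set.mem_union, not_or] at hcon
  refine hx ?_
  have hx' : ψ • x = ψ' • x := hinj hcon.1 hcon.2 (h x)
  rw [mul_smul, hx', inv_smul_smul]

lemma mem_projEquivs_of_forall_smul_eq (p q : RationalCurve n d) {φ : ProjAut n} {ψ : ProjAut 1}
    (h : ∀ x : ProjSpace 1, φ • p.toMap x = q.toMap (ψ • x)) :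
    φ ∈ projEquivs p.points q.points := by
  change (fun x => φ • x) '' Set.range p.toMap = Set.range q.toMap
  rw [← Set.range_comp]
  change Set.range (fun x => φ • p.toMap x) = _
  simp_rw [h]
  exact (MulAction.surjective ψ).range_comp q.toMap

lemma forall_smul_toMap_eq_iff (p q : ProjLineMorphism n d) (M : GL (Fin (n + 1)) ℂ)
    (A : GL (Fin 2) ℂ) :
    (∀ x, (Matrix.ProjGenLinGroup.mk M : ProjAut n) • p.toMap x =
      q.toMap ((Matrix.ProjGenLinGroup.mk A : ProjAut 1) • x)) ↔
      ∃ c : ℂ, c ≠ 0 ∧ ∀ i, ∑ j, C (M i j) * p.coord j = C c * substForm A (q.coord i) := by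
  simp_rw [← ProjLineMorphism.toMap_transform]
  exact (p.transform M).toMap_eq_smul_iff q A

/-- A projective equivalence of rational curves of the same degree lifts to the parameters. -/
lemma exists_projAut_of_mem_projEquivs (hd : d ≠ 0) (p q : RationalCurve n d) {φ : ProjAut n}
    (h : φ ∈ projEquivs p.points q.points) :
    ∃ ψ : ProjAut 1, ∀ x : ProjSpace 1, φ • p.toMap x = q.toMap (ψ • x) := by
  induction φ using Matrix.ProjGenLinGroup.induction_on with
  | mk M =>
    obtain ⟨S, hS, hinj⟩ := p.birational
    have hr : ∃ S : Set (ProjSpace 1), S.Finite ∧ Set.InjOn (p.transform M).toMap Sᶜ := by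
      refine ⟨S, hS, fun x hx y hy hxy => hinj hx hy ?_⟩
      rw [ProjLineMorphism.toMap_transform, ProjLineMorphism.toMap_transform] at hxy
      exact MulAction.injective _ hxy
    have hrange : Set.range (p.transform M).toMap ⊆ Set.range q.toMap := by
      rintro _ ⟨x, rfl⟩
      rw [ProjLineMorphism.toMap_transform]
      exact h.subset ⟨_, ⟨x, rfl⟩, rfl⟩
    obtain ⟨A, c, hc, hA⟩ :=
      ProjLineMorphism.exists_eq_substForm_of_range_subset hd hr q.birational hrange
    exact ⟨_, (forall_smul_toMap_eq_iff p.toProjLineMorphism q.toProjLineMorphism M A).2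
      ⟨c, hc, hA⟩⟩

lemma projAut_eq_of_forall_smul_eq (p q : RationalCurve n d) {φ φ' : ProjAut n} {ψ : ProjAut 1}
    (h : ∀ x : ProjSpace 1, φ • p.toMap x = q.toMap (ψ • x))
    (h' : ∀ x : ProjSpace 1, φ' • p.toMap x = q.toMap (ψ • x)) : φ = φ' := by
  induction φ using Matrix.ProjGenLinGroup.induction_on with
  | mk M =>
  induction φ' using Matrix.ProjGenLinGroup.induction_on with
  | mk M' =>
  obtain ⟨A, rfl⟩ := Matrix.ProjGenLinGroup.mk_surjective ψ
  obtain ⟨c, hc, hM⟩ := (forall_smul_toMap_eq_iff _ _ _ _).1 h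
  obtain ⟨c', hc', hM'⟩ := (forall_smul_toMap_eq_iff _ _ _ _).1 h'
  have hli := Fintype.linearIndependent_iff.1 p.nondegenerate
  have hcoef : ∀ i j, c' * M i j = c * M' i j := by
    intro i j
    refine sub_eq_zero.1 (hli (fun j => c' * M i j - c * M' i j) ?_ j)
    have e : ∀ j, (c' * M i j - c * M' i j) • p.coord j =
        C c' * (C (M i j) * p.coord j) - C c * (C (M' i j) * p.coord j) := fun j => by
      rw [smul_eq_C_mul, C_sub, C_mul, C_mul]
      ring
    simp_rw [e]
    rw [Finset.sum_sub_distrib, ← Finset.mul_sum, ← Finset.mul_sum, hM, hM']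
    ring
  refine Matrix.ProjGenLinGroup.mk_eq_mk_iff.2 ⟨Units.mk0 (c' / c) (div_ne_zero hc' hc), ?_⟩
  ext i j
  have := hcoef i j
  simp only [Units.val_mul, Matrix.GeneralLinearGroup.coe_scalar, Units.val_mk0]
  rw [Matrix.scalar_apply, Matrix.mul_diagonal]
  field_simp
  rw [mul_comm, this]

lemma mem_formEquivs_of_forall_smul_eq (p q : RationalCurve n (n + 1)) {φ : ProjAut n}
    {ψ : ProjAut 1} (h : ∀ x : ProjSpace 1, φ • p.toMap x = q.toMap (ψ • x)) :
    ψ ∈ formEquivs p.osculating q.osculating := by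
  induction φ using Matrix.ProjGenLinGroup.induction_on with
  | mk M =>
  obtain ⟨A, rfl⟩ := Matrix.ProjGenLinGroup.mk_surjective ψ
  obtain ⟨c, hc, hM⟩ := (forall_smul_toMap_eq_iff _ _ _ _).1 h
  refine ⟨A, rfl, (ProjLineMorphism.substForm_mem_span_iff _ _ p.nondegenerate
    q.nondegenerate A).1 fun i => ?_⟩
  have e : substForm A (q.coord i) = ∑ j, (c⁻¹ * M i j) • p.coord j := by
    simp_rw [smul_eq_C_mul, C_mul, mul_assoc]
    rw [← Finset.mul_sum, hM, ← mul_assoc, ← C_mul, inv_mul_cancel₀ hc, C_1, one_mul]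
  rw [e]
  exact Submodule.sum_mem _ fun j _ => Submodule.smul_mem _ _ (Submodule.subset_span ⟨j, rfl⟩)

lemma exists_projAut_of_mem_formEquivs (p q : RationalCurve n (n + 1)) {ψ : ProjAut 1}
    (h : ψ ∈ formEquivs p.osculating q.osculating) :
    ∃ φ : ProjAut n, ∀ x : ProjSpace 1, φ • p.toMap x = q.toMap (ψ • x) := by
  obtain ⟨A, rfl, hA⟩ := h
  have hspan := (ProjLineMorphism.substForm_mem_span_iff _ _ p.nondegenerate
    q.nondegenerate A).2 hA
  simp_rw [Submodule.mem_span_range_iff_exists_fun] at hspan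
  choose M hM using hspan
  -- A linear relation among the rows of `M` is one among the forms qᵢ ∘ A, hence, substitution
  -- being injective, among the independent qᵢ.
  have hdet : (Matrix.of M).det ≠ 0 := by
    intro h0
    obtain ⟨w, hw, hwM⟩ := Matrix.exists_vecMul_eq_zero_iff.2 h0
    have hsum : ∑ i, w i • q.coord i = 0 := by
      refine substHom_injective A ?_
      rw [map_sum, map_zero]
      simp_rw [map_smul, substHom_apply, ← hM, Finset.smul_sum, smul_smul]
      rw [Finset.sum_comm]
      simp_rw [← Finset.sum_smul]
      refine Finset.sum_eq_zero fun j _ => ?_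
      have : ∑ i, w i * M i j = 0 := congrFun hwM j
      rw [this, zero_smul]
    exact hw (funext (Fintype.linearIndependent_iff.1 q.nondegenerate w hsum))
  refine ⟨Matrix.ProjGenLinGroup.mk (Matrix.GeneralLinearGroup.mkOfDetNeZero _ hdet),
    (forall_smul_toMap_eq_iff _ _ _ _).2 ⟨1, one_ne_zero, fun i => ?_⟩⟩
  rw [C_1, one_mul, ← hM]
  simp_rw [smul_eq_C_mul]
  rfl

end RationalCurve
end OsculatingCurves
end

open OsculatingCurves in
theorem mainTheorem2 (n : ℕ) (p q : OsculatingCurves.RationalCurve n (n + 1)) :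
    (∃ ι : OsculatingCurves.projEquivs p.points q.points →
        OsculatingCurves.formEquivs p.osculating q.osculating,
      (∀ (φ : OsculatingCurves.projEquivs p.points q.points) (ψ : OsculatingCurves.ProjAut 1),
        (∀ x : OsculatingCurves.ProjSpace 1,
          (φ : OsculatingCurves.ProjAut n) • p.toMap x = q.toMap (ψ • x)) ↔
        ψ = (ι φ : OsculatingCurves.ProjAut 1)) ∧
      Function.Bijective ι) ∧
    ((OsculatingCurves.projEquivs p.points q.points).Nonempty ↔
      (OsculatingCurves.formEquivs p.osculating q.osculating).Nonempty) := by
  choose f hf using fun φ : projEquivs p.points q.points =>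
    RationalCurve.exists_projAut_of_mem_projEquivs n.succ_ne_zero p q φ.2
  let ι : projEquivs p.points q.points → formEquivs p.osculating q.osculating :=
    fun φ => ⟨f φ, RationalCurve.mem_formEquivs_of_forall_smul_eq p q (hf φ)⟩
  have hι : ∀ (φ : projEquivs p.points q.points) (ψ : ProjAut 1),
      (∀ x : ProjSpace 1, (φ : ProjAut n) • p.toMap x = q.toMap (ψ • x)) ↔
        ψ = (ι φ : ProjAut 1) := by
    intro φ ψ
    constructor
    · exact fun h => q.projAut_eq_of_toMap_smul_eq fun x => (h x).symm.trans (hf φ x)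
    · rintro rfl
      exact hf φ
  have hsurj : Function.Surjective ι := by
    rintro ⟨ψ, hψ⟩
    obtain ⟨φ, hφ⟩ := RationalCurve.exists_projAut_of_mem_formEquivs p q hψ
    exact ⟨⟨φ, RationalCurve.mem_projEquivs_of_forall_smul_eq p q hφ⟩,
      Subtype.ext ((hι ⟨φ, _⟩ ψ).1 hφ).symm⟩
  refine ⟨⟨ι, hι, fun φ φ' h => ?_, hsurj⟩, ?_, ?_⟩
  · exact Subtype.ext (RationalCurve.projAut_eq_of_forall_smul_eq p q (hf φ)
      ((hι φ' _).2 (congrArg Subtype.val h)))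
  · rintro ⟨φ, hφ⟩
    exact ⟨_, (ι ⟨φ, hφ⟩).2⟩
  · rintro ⟨ψ, hψ⟩
    obtain ⟨φ, -⟩ := hsurj ⟨ψ, hψ⟩
    exact ⟨_, φ.2⟩
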